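/- Let $\Bbbk$ be an algebraically closed field and let $r\ge 1$. A *tube of rank $r$* is a $\Bbbk$-linear abelian category $\mathcal T$ that is $\Bbbk$-linearly equivalent to the category of finite-dimensional nilpotent representations over $\Bbbk$ of the cyclic quiver with $r$ vertices and $r$ arrows $i\to i+1$ (indices mod $r$). For a finite family $\phi=\{X_1,\dots,X_n\}$ of objects of $\mathcal T$, the adjacency matrix is $C(\phi)=(\dim_{\Bbbk}\operatorname{Ext}^1_{\mathcal T}(X_i,X_j))_{i,j}$. The family $\phi$ is a *brick set* if $\operatorname{Hom}_{\mathcal T}(X_i,X_i)=\Bbbk$ for all $i$ and $\dim_{\Bbbk}\operatorname{Hom}_{\mathcal T}(X_i,X_j)=\delta_{ij}$ for all $i,j$. Let $\rho(C)$ be the largest absolute value of a complex eigenvalue of $C$, and let $$\operatorname{fpdim}(\mathcal T)=\sup_{n\ge1}\ \sup\{\rho(C(\phi)) : \phi \text{ a brick set with } n \text{ objects}\}.$$ A square matrix is *irreducible* if no simultaneous permutation of its rows and columns brings it to the form $\begin{pmatrix}C_1&C_2\\0&C_3\end{pmatrix}$ with square blocks $C_1,C_3$ of size at least $1$. The *$n\times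 n$ cyclic permutation matrix* has entries $1$ at the places $(i,i+1)$, indices mod $n$, and $0$ elsewhere; for $n=1$ it is $(1)$. Let $\mathcal T$ be a tube of rank $r$. Then all spaces $\operatorname{Ext}^1_{\mathcal T}(X,Y)$ are finite-dimensional over $\Bbbk$, and $$\operatorname{fpdim}(\mathcal T)=1.$$ Moreover, if the adjacency matrix of a nonempty finite brick set in $\mathcal T$ is irreducible, then it is either the $1\times1$ matrix $(0)$ or, for a suitable order of the objects, the $n\times n$ cyclic permutation matrix. There is a set of $r$ simple objects of $\mathcal T$ that contains every simple object up to isomorphism, is a brick set, and has, in a suitable order, the $r\times r$ cyclic permutation matrix as its adjacency matrix; in particular its adjacency matrix has spectral radius $1$. -/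

import Mathlib

open CategoryTheory CategoryTheory.Abelian
open scoped ENNReal

universe w v u t

noncomputable section

namespace FPTube

/-! ### Brick sets and the Frobenius-Perron dimension -/

section FPDim

variable (k : Type t) [Field k] {C : Type u} [Category.{v} C] [Abelian C] [Linear k C]

/-- A brick is an object `M` with `Hom(M, M) = k`: every endomorphism is a unique scalar multiple
of the identity. -/
def IsBrick (M : C) : Prop :=
  Function.Bijective (fun a : k => a • 𝟙 M)

/-- The family `X 0, …, X (n - 1)` is a brick set: every member is a brick, and
`dim Hom(X i, X j)` is the Kronecker delta. The members are then nonzero and pairwise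
non-isomorphic, so the family lists a set of exactly `n` objects. -/
def IsBrickSet {n : ℕ} (X : Fin n → C) : Prop :=
  (∀ i, IsBrick k (X i)) ∧
    ∀ i j, Module.rank k (X i ⟶ X j) = if i = j then 1 else 0

/-- The adjacency matrix `(dim Ext¹(X i, X j))` of a finite family of objects of a category
whose first extension spaces are finite-dimensional. -/
def adjacencyMatrix [HasExt.{w} C] {n : ℕ} (X : Fin n → C) : Matrix (Fin n) (Fin n) ℕ :=
  Matrix.of fun i j => Module.finrank k (Ext.{w} (X i) (X j) 1)

/-- The largest absolute value of a complex eigenvalue of a square matrix of natural numbers. -/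
def rho {n : ℕ} (A : Matrix (Fin n) (Fin n) ℕ) : ℝ≥0∞ :=
  spectralRadius ℂ (A.map (Nat.cast : ℕ → ℂ))

variable (C)

/-- The `n`-th Frobenius-Perron dimension (it is `0` if there is no brick set with `n` objects). -/
def fpdimN [HasExt.{w} C] (n : ℕ) : ℝ≥0∞ :=
  ⨆ (X : Fin n → C) (_ : IsBrickSet k X), rho (adjacencyMatrix.{w} k X)

/-- The Frobenius-Perron dimension, the supremum over all nonempty finite brick sets. -/
def fpdim [HasExt.{w} C] : ℝ≥0∞ :=
  ⨆ (n : ℕ) (_ : 1 ≤ n), fpdimN.{w} k C n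

end FPDim

/-! ### Irreducible matrices -/

/-- A square matrix is irreducible if no simultaneous permutation of its rows and columns brings
it into the form `(C₁ C₂; 0 C₃)` with square diagonal blocks `C₁`, `C₃` of positive size. -/
def IsIrreducibleMatrix {n : ℕ} (A : Matrix (Fin n) (Fin n) ℕ) : Prop :=
  ¬ ∃ (p q : ℕ) (e : Fin n ≃ Fin p ⊕ Fin q),
      1 ≤ p ∧ 1 ≤ q ∧ (Matrix.reindex e e A).toBlocks₂₁ = 0

/-- The matrix with entries `1` at the places `(i, i + 1)`, indices modulo `n`, and `0` elsewhere;
for `n = 1` it is `(1)`. -/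
def cyclicMatrix (n : ℕ) : Matrix (Fin n) (Fin n) ℕ :=
  (finRotate n).permMatrix ℕ

/-! ### Tubes -/

/-- The vertices of the cyclic quiver with `r` vertices. -/
def CyclicQuiver (r : ℕ) : Type := ZMod r

/-- The cyclic quiver has exactly one arrow `i ⟶ i + 1` for each vertex `i`. For `r = 1` this is
one vertex with one loop. -/
instance (r : ℕ) : Quiver.{0} (CyclicQuiver r) where
  Hom i j := PLift ((show ZMod r from j) = (show ZMod r from i) + 1)

/-- Finite-dimensional representations over `k` of the cyclic quiver with `r` vertices: functors
from its path category to finite-dimensional vector spaces. -/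
abbrev CyclicRep (k : Type t) [Field k] (r : ℕ) :=
  Paths (CyclicQuiver r) ⥤ FGModuleCat.{t} k

/-- A representation is nilpotent if all sufficiently long paths act as zero. -/
def nilpotentRep (k : Type t) [Field k] (r : ℕ) : ObjectProperty (CyclicRep k r) :=
  fun F => ∃ N : ℕ, ∀ (a b : CyclicQuiver r) (p : Quiver.Path a b),
    N ≤ p.length → F.map (X := (Paths.of (CyclicQuiver r)).obj a)
      (Y := (Paths.of (CyclicQuiver r)).obj b) p = 0

/-- The category of finite-dimensional nilpotent representations of the cyclic quiver with `r`
vertices: the standard model of the tube of rank `r`. -/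
abbrev NilpotentCyclicRep (k : Type t) [Field k] (r : ℕ) :=
  (nilpotentRep k r).FullSubcategory

/-- A `k`-linear abelian category is a tube of rank `r ≥ 1` if it is equivalent, by a `k`-linear
equivalence, to the category of finite-dimensional nilpotent representations of the cyclic quiver
with `r` vertices. -/
def IsTube (k : Type t) [Field k] (r : ℕ) (T : Type u) [Category.{v} T] [Abelian T]
    [Linear k T] : Prop :=
  1 ≤ r ∧ ∃ e : T ≌ NilpotentCyclicRep k r, e.functor.Additive ∧ e.functor.Linear k

end FPTube

end

/-!
A nilpotent representation of the cyclic quiver is encoded by its total space, a `ZMod r`-graded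
vector space with a nilpotent endomorphism `x` of degree one (`CycMod`, `totalFunctor`). A tube is
thereby equivalent to a category of graded modules (`IsTube.exists_isTotalSpace`), and the functor
to these modules is exact.

Bricks are uniserial. If every endomorphism of a graded module is a scalar, then the nilpotent
endomorphism `xʳ` vanishes, and a homogeneous element `v` that survives the highest nonzero power
`xᴺ` spans, together with `x v, …, xᴺ v`, a direct summand, hence everything
(`CycMod.exists_isUniserial`). So a brick has a basis `v, x v, …, xᴺ v` with `N < r`, and it is
determined by `N` and the degree `a` of `v`.

The spaces `Ext¹` are computed from truncated induced modules. A class in `Ext¹(X, Y)` dies after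
pullback to the middle term of an extension of `X` by `Y`
(`exists_shortExact_mk₀_comp_eq_zero`), and this middle term is killed by a power `xⁿ⁺¹`. The
induced module `V ⊗ k[x]/(xⁿ⁺¹)` is projective among the modules killed by `xⁿ⁺¹`
(`CycMod.ind_lift`). Hence, for a cover of `X` by such a module with kernel `K`, the connecting map
`Hom(K, Y) ⟶ Ext¹(X, Y)` is onto (`connectingMap_surjective`). In particular `Ext¹(X, Y)` is
finite-dimensional (`finite_ext`). For `X` and `Y` as above, `K` is again uniserial, so that
`dim Ext¹(X, Y) ≤ 1`, and if the dimension is `1`, then some `xˢ v'` in `Y` with `s ≤ N` has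
degree `a + N + 1` (`finrank_ext_le_one`).

In a brick set this forces `s = 0`: otherwise a suitable power of `x` applied to the generator of
`X` is the image of the generator of `Y` under a nonzero map `Y ⟶ X`, or, if `X = Y`, the degrees
do not match. So `Ext¹(X, Y) ≠ 0` only if the top of `Y` is in the degree that follows the socle of
`X`. Two members of a brick set with the same top, or with the same socle, coincide, because one of
them would map onto, or embed into, the other. Therefore the adjacency matrix has entries `0` and
`1`, with at most one `1` in each row and each column (`IsBrickSet.isPartialPerm`). Its maximal row
sum is at most `1`, which bounds the spectral radius, and if it is irreducible, then it is `(0)` or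
the matrix of a single cycle (`IsPartialPerm.eq_zero_or_cyclic`). The simple objects, one in each
degree, form a brick set with the cyclic permutation matrix (`adjacencyMatrix_simples`), whose
spectral radius is `1`.
-/

noncomputable section

namespace FPTube

/-! ### Classes in `Ext¹` as short exact sequences -/

section ExtensionClasses

open DerivedCategory Pretriangulated Triangulated Limits

variable {C : Type u} [Category.{v} C] [Abelian C]

/-- The negative extension group `Ext⁻¹(U, V)` vanishes. -/
theorem singleFunctor_shift_hom_eq_zero [HasDerivedCategory.{t} C] {U V : C}
    (q : ((singleFunctor C 0).obj U)⟦(1 : ℤ)⟧ ⟶ (singleFunctor C 0).obj V) : q = 0 := by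
  have h := (TStructure.t (C := C)).isLE_shift ((singleFunctor C 0).obj U) 0 1 (-1) (by simp)
  exact TStructure.t.zero q (-1) 0 (by simp)

/-- Every class in `Ext¹(X, Y)` comes from a short exact sequence `0 ⟶ Y ⟶ E ⟶ X ⟶ 0`; only its
vanishing after pullback to `E` is recorded. The object `E` is found in the derived category, as
the extension of two objects of the heart of the canonical t-structure. -/
theorem exists_shortExact_mk₀_comp_eq_zero [HasExt.{w} C] {X Y : C} (α : Ext.{w} X Y 1) :
    ∃ (E : C) (f : Y ⟶ E) (g : E ⟶ X) (h : f ≫ g = 0), (ShortComplex.mk f g h).ShortExact ∧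
      (Ext.mk₀ g).comp α (zero_add 1) = 0 := by
  let := HasDerivedCategory.standard C
  obtain ⟨E', i, p, hT⟩ := distinguished_cocone_triangle₂ (C := DerivedCategory C)
    (Z := (singleFunctor C 0).obj X) (X := (singleFunctor C 0).obj Y) α.hom
  have hle : E'.IsLE 0 := TStructure.t.isLE₂ _ hT 0
    (inferInstance : ((singleFunctor C 0).obj Y).IsLE 0)
    (inferInstance : ((singleFunctor C 0).obj X).IsLE 0)
  have hge : E'.IsGE 0 := TStructure.t.isGE₂ _ hT 0
    (inferInstance : ((singleFunctor C 0).obj Y).IsGE 0)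
    (inferInstance : ((singleFunctor C 0).obj X).IsGE 0)
  obtain ⟨E, ⟨e⟩⟩ := exists_iso_singleFunctor_obj_of_isGE_of_isLE E' 0
  obtain ⟨f, hf⟩ := (singleFunctor C 0).map_surjective (i ≫ e.hom)
  obtain ⟨g, hg⟩ := (singleFunctor C 0).map_surjective (e.inv ≫ p)
  have hip : i ≫ p = 0 := comp_distTriang_mor_zero₁₂ _ hT
  have hpα : p ≫ α.hom = 0 := comp_distTriang_mor_zero₂₃ _ hT
  have hfg : f ≫ g = 0 := (singleFunctor C 0).map_injective (by simp [hf, hg, hip])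
  -- a map that `f` kills comes from the shift of a class in `Ext⁻¹`, and dually for `g`
  have hmono : Mono f := by
    refine Preadditive.mono_of_cancel_zero _ fun {Z} q hq ↦ (singleFunctor C 0).map_injective ?_
    have h : (singleFunctor C 0).map q ≫ i = 0 := by
      rw [← cancel_mono e.hom, Category.assoc, ← hf, ← Functor.map_comp, hq]; simp
    have h' : ((singleFunctor C 0).map q)⟦(1 : ℤ)⟧' ≫ i⟦(1 : ℤ)⟧' = 0 := by
      rw [← Functor.map_comp, h, Functor.map_zero]
    obtain ⟨s, hs⟩ : ∃ s : ((singleFunctor C 0).obj Z)⟦(1 : ℤ)⟧ ⟶ (singleFunctor C 0).obj X,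
        ((singleFunctor C 0).map q)⟦(1 : ℤ)⟧' = s ≫ α.hom := Triangle.coyoneda_exact₁ _ hT _ h'
    refine (shiftFunctor (DerivedCategory C) (1 : ℤ)).map_injective ?_
    rw [hs, singleFunctor_shift_hom_eq_zero s, zero_comp, Functor.map_zero, Functor.map_zero]
  have hepi : Epi g := by
    refine Preadditive.epi_of_cancel_zero _ fun {Z} q hq ↦ (singleFunctor C 0).map_injective ?_
    have h : p ≫ (singleFunctor C 0).map q = 0 := by
      rw [← cancel_epi e.inv, ← Category.assoc, ← hg, ← Functor.map_comp, hq]; simp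
    obtain ⟨s, hs⟩ : ∃ s : ((singleFunctor C 0).obj Y)⟦(1 : ℤ)⟧ ⟶ (singleFunctor C 0).obj Z,
        (singleFunctor C 0).map q = α.hom ≫ s := Triangle.yoneda_exact₃ _ hT _ h
    rw [hs, singleFunctor_shift_hom_eq_zero s, comp_zero, Functor.map_zero]
  refine ⟨E, f, g, hfg, ?_, ?_⟩
  · have key {Z : C} (q : Z ⟶ E) (hq : q ≫ g = 0) : ∃ l : Z ⟶ Y, l ≫ f = q := by
      have h : ((singleFunctor C 0).map q ≫ e.inv) ≫ p = 0 := by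
        rw [Category.assoc, ← hg, ← Functor.map_comp, hq]; simp
      obtain ⟨s, hs⟩ : ∃ s : (singleFunctor C 0).obj Z ⟶ (singleFunctor C 0).obj Y,
          (singleFunctor C 0).map q ≫ e.inv = s ≫ i := Triangle.coyoneda_exact₂ _ hT _ h
      obtain ⟨l, rfl⟩ := (singleFunctor C 0).map_surjective s
      refine ⟨l, (singleFunctor C 0).map_injective ?_⟩
      rw [Functor.map_comp, hf, ← Category.assoc, ← hs, Category.assoc, e.inv_hom_id,
        Category.comp_id]
    exact { exact := ShortComplex.exact_of_f_is_kernel _ (KernelFork.IsLimit.ofι' _ _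
      fun q hq ↦ ⟨(key q hq).choose, (key q hq).choose_spec⟩) }
  · ext
    rw [Ext.comp_hom, Ext.mk₀_hom, ShiftedHom.mk₀_comp, hg, Category.assoc, hpα, comp_zero,
      Ext.zero_hom]

variable (k : Type t) [Field k] [Linear k C] [HasExt.{w} C]

/-- The connecting map `Hom(S.X₁, Y) ⟶ Ext¹(S.X₃, Y)` of a short exact sequence. -/
def connectingMap {S : ShortComplex C} (hS : S.ShortExact) (Y : C) :
    (S.X₁ ⟶ Y) →ₗ[k] Ext.{w} S.X₃ Y 1 :=
  hS.extClass.precompOfLinear k Y (add_zero 1) ∘ₗ (Ext.linearEquiv₀ (R := k)).symm.toLinearMap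

variable {k}

theorem connectingMap_apply {S : ShortComplex C} (hS : S.ShortExact) {Y : C} (g : S.X₁ ⟶ Y) :
    connectingMap.{w} k hS Y g = hS.extClass.comp (Ext.mk₀ g) (add_zero 1) := rfl

theorem connectingMap_eq_zero_iff {S : ShortComplex C} (hS : S.ShortExact) {Y : C}
    (g : S.X₁ ⟶ Y) : connectingMap.{w} k hS Y g = 0 ↔ ∃ f : S.X₂ ⟶ Y, S.f ≫ f = g := by
  rw [connectingMap_apply]
  constructor
  · intro h
    obtain ⟨x, hx⟩ := Ext.contravariant_sequence_exact₁ hS Y (Ext.mk₀ g) (add_zero 1) h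
    obtain ⟨f, rfl⟩ := (Ext.mk₀_bijective _ _).2 x
    exact ⟨f, (Ext.mk₀_bijective _ _).1 (by rw [← hx, Ext.mk₀_comp_mk₀])⟩
  · rintro ⟨f, rfl⟩
    rw [← Ext.mk₀_comp_mk₀, hS.extClass_comp_assoc]

theorem exists_connectingMap_eq {S : ShortComplex C} (hS : S.ShortExact) {Y : C}
    (α : Ext.{w} S.X₃ Y 1) (h : (Ext.mk₀ S.g).comp α (zero_add 1) = 0) :
    ∃ g, connectingMap k hS Y g = α := by
  obtain ⟨x, hx⟩ := Ext.contravariant_sequence_exact₃ hS Y α h (add_zero 1)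
  obtain ⟨g, rfl⟩ := (Ext.mk₀_bijective _ _).2 x
  exact ⟨g, hx⟩

end ExtensionClasses

/-! ### Graded nilpotent modules -/

/-- A finite-dimensional nilpotent representation of the cyclic quiver, encoded by its total space
`V`: the arrows add up to the nilpotent endomorphism `x`, and `π i` is the projection of `V` onto
the space at the vertex `i`. -/
structure CycMod (k : Type t) [Field k] (r : ℕ) [NeZero r] where
  V : Type t
  [addCommGroup : AddCommGroup V]
  [module : Module k V]
  [finite : Module.Finite k V]
  x : Module.End k V
  π : ZMod r → Module.End k V
  π_π : ∀ i j v, π i (π j v) = if i = j then π i v else 0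
  sum_π : ∀ v, ∑ i, π i v = v
  x_π : ∀ i v, x (π i v) = π (i + 1) (x v)
  nilpotent : IsNilpotent x

namespace CycMod

attribute [instance] CycMod.addCommGroup CycMod.module CycMod.finite

variable {k : Type t} [Field k] {r : ℕ} [NeZero r]

/-- A morphism is a linear map that commutes with `x` and with the projections. -/
@[ext]
structure Hom (A B : CycMod k r) where
  lin : A.V →ₗ[k] B.V
  lin_x : ∀ v, lin (A.x v) = B.x (lin v)
  lin_π : ∀ i v, lin (A.π i v) = B.π i (lin v)

instance : Category (CycMod k r) where
  Hom := Hom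
  id A := ⟨LinearMap.id, fun _ ↦ rfl, fun _ _ ↦ rfl⟩
  comp f g := ⟨g.lin ∘ₗ f.lin, fun v ↦ by simp [f.lin_x, g.lin_x],
    fun i v ↦ by simp [f.lin_π, g.lin_π]⟩

@[ext]
theorem hom_ext {A B : CycMod k r} {f g : A ⟶ B} (h : f.lin = g.lin) : f = g :=
  Hom.ext h

@[simp]
theorem comp_lin {A B C : CycMod k r} (f : A ⟶ B) (g : B ⟶ C) :
    (f ≫ g).lin = g.lin ∘ₗ f.lin := rfl

/-- A linear equivalence that commutes with `x` and with the projections is an isomorphism. -/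
def isoOfLinearEquiv {A B : CycMod k r} (e : A.V ≃ₗ[k] B.V) (hx : ∀ v, e (A.x v) = B.x (e v))
    (hπ : ∀ i v, e (A.π i v) = B.π i (e v)) : A ≅ B where
  hom := ⟨e, hx, hπ⟩
  inv := ⟨e.symm, fun v ↦ e.injective (by simp [hx]), fun i v ↦ e.injective (by simp [hπ])⟩
  hom_inv_id := by ext v; exact e.symm_apply_apply v
  inv_hom_id := by ext v; exact e.apply_symm_apply v

end CycMod

/-! ### Nilpotent representations as graded nilpotent modules -/

section Total

variable {k : Type t} [Field k] {r : ℕ}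

/-- The arrow `i ⟶ j` of the cyclic quiver, for `j = i + 1`. -/
def cycArrow (i j : ZMod r) (h : j = i + 1) :
    (Paths.of (CyclicQuiver r)).obj i ⟶ (Paths.of (CyclicQuiver r)).obj j :=
  (Paths.of (CyclicQuiver r)).map (X := i) (Y := j) ⟨h⟩

/-- The space of a representation at the vertex `i`. -/
abbrev vertexSpace (F : CyclicRep k r) (i : ZMod r) : FGModuleCat.{t} k :=
  F.obj ((Paths.of (CyclicQuiver r)).obj i)

/-- The map of a representation along the arrow `i ⟶ j`. -/
abbrev arrowMap (F : CyclicRep k r) (i j : ZMod r) (h : j = i + 1) :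
    vertexSpace F i →ₗ[k] vertexSpace F j :=
  (F.map (cycArrow i j h)).hom.hom

/-- The sum of all arrow maps, an endomorphism of the total space. -/
def totalArrow (F : CyclicRep k r) : Module.End k (∀ i, vertexSpace F i) :=
  LinearMap.pi fun i ↦ arrowMap F (i - 1) i (by ring) ∘ₗ LinearMap.proj (i - 1)

theorem totalArrow_apply (F : CyclicRep k r) (m : ∀ i, vertexSpace F i) (i j : ZMod r)
    (h : j = i + 1) : totalArrow F m j = arrowMap F i j h (m i) := by
  obtain rfl : i = j - 1 := by rw [h]; ring
  rfl

/-- The components of a power of the total arrow are given by paths of that length. -/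
theorem totalArrow_pow_apply (F : CyclicRep k r) (n : ℕ) (m : ∀ i, vertexSpace F i) (i : ZMod r) :
    ∃ (j : CyclicQuiver r) (p : Quiver.Path j (show CyclicQuiver r from i)), p.length = n ∧
      (totalArrow F ^ n) m i = (F.map (X := (Paths.of (CyclicQuiver r)).obj j)
        (Y := (Paths.of (CyclicQuiver r)).obj i) p).hom.hom (m j) := by
  induction n generalizing i with
  | zero =>
    refine ⟨i, Quiver.Path.nil, rfl, ?_⟩
    have := F.map_id ((Paths.of (CyclicQuiver r)).obj i)
    exact (congrArg (fun q ↦ q.hom.hom (m i)) this).symm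
  | succ n ih =>
    obtain ⟨j, p, hp, h⟩ := ih (i - 1)
    refine ⟨j, p.cons ⟨by ring⟩, congrArg (· + 1) hp, ?_⟩
    rw [pow_succ', Module.End.mul_apply, totalArrow_apply F _ (i - 1) i (by ring), h]
    have := F.map_comp (X := (Paths.of (CyclicQuiver r)).obj j)
       (Y := (Paths.of (CyclicQuiver r)).obj (i - 1 : ZMod r)) p (cycArrow (i - 1) i (by ring))
    exact (congrArg (fun q ↦ q.hom.hom (m j)) this).symm

/-- The projection of the total space to the space at the vertex `i`. -/
def totalProj (F : CyclicRep k r) (i : ZMod r) : Module.End k (∀ i, vertexSpace F i) :=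
  LinearMap.single k _ i ∘ₗ LinearMap.proj i

theorem totalProj_apply (F : CyclicRep k r) (i : ZMod r) (m : ∀ i, vertexSpace F i) :
    totalProj F i m = Pi.single i (m i) := rfl

theorem totalArrow_totalProj (F : CyclicRep k r) (i : ZMod r) (m : ∀ i, vertexSpace F i) :
    totalArrow F (totalProj F i m) = totalProj F (i + 1) (totalArrow F m) := by
  ext j
  rcases eq_or_ne j (i + 1) with rfl | h
  · rw [totalArrow_apply F _ i (i + 1) rfl, totalProj_apply, totalProj_apply, Pi.single_eq_same,
      Pi.single_eq_same, totalArrow_apply F _ i (i + 1) rfl]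
  · have h' : j - 1 ≠ i := fun h' ↦ h (by rw [← h']; ring)
    rw [totalArrow_apply F _ (j - 1) j (by ring), totalProj_apply, totalProj_apply,
      Pi.single_eq_of_ne h, Pi.single_eq_of_ne h', map_zero]

/-- The map on total spaces induced by a morphism of representations. -/
def totalMap {F G : CyclicRep k r} (f : F ⟶ G) :
    (∀ i, vertexSpace F i) →ₗ[k] (∀ i, vertexSpace G i) :=
  LinearMap.pi fun i ↦ (f.app ((Paths.of (CyclicQuiver r)).obj i)).hom.hom ∘ₗ LinearMap.proj i

theorem totalMap_totalArrow {F G : CyclicRep k r} (f : F ⟶ G) (m : ∀ i, vertexSpace F i) :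
    totalMap f (totalArrow F m) = totalArrow G (totalMap f m) := by
  ext j
  rw [totalArrow_apply G _ (j - 1) j (by ring)]
  exact congrArg (fun q ↦ q.hom.hom (m (j - 1))) (f.naturality (cycArrow (j - 1) j (by ring)))

theorem totalMap_totalProj {F G : CyclicRep k r} (f : F ⟶ G) (i : ZMod r)
    (m : ∀ i, vertexSpace F i) :
    totalMap f (totalProj F i m) = totalProj G i (totalMap f m) := by
  ext j
  rcases eq_or_ne j i with rfl | h
  · simp [totalProj_apply, totalMap]
  · simp [totalProj_apply, totalMap, h]

variable [NeZero r]

/-- The total space of a nilpotent representation. -/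
def totalSpace (F : NilpotentCyclicRep k r) : CycMod k r where
  V := ∀ i, vertexSpace F.obj i
  x := totalArrow F.obj
  π i := totalProj F.obj i
  π_π i j v := by
    rcases eq_or_ne i j with rfl | h
    · simp [totalProj_apply]
    · simp [totalProj_apply, h]
  sum_π v := by
    simpa [totalProj_apply] using Finset.univ_sum_single v
  x_π := totalArrow_totalProj F.obj
  nilpotent := by
    obtain ⟨N, hN⟩ := F.property
    refine ⟨N, LinearMap.ext fun m ↦ funext fun i ↦ ?_⟩
    obtain ⟨j, p, hp, h⟩ := totalArrow_pow_apply F.obj N m i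
    rw [h, hN _ _ p hp.ge]
    rfl

variable (k r) in
/-- The total space, as a functor. -/
def totalFunctor : NilpotentCyclicRep k r ⥤ CycMod k r where
  obj := totalSpace
  map f := ⟨totalMap f.hom, totalMap_totalArrow f.hom, totalMap_totalProj f.hom⟩

theorem totalFunctor_map_add {F G : NilpotentCyclicRep k r} (f g : F ⟶ G) :
    ((totalFunctor k r).map (f + g)).lin =
      ((totalFunctor k r).map f).lin + ((totalFunctor k r).map g).lin := rfl

theorem totalFunctor_map_smul {F G : NilpotentCyclicRep k r} (c : k) (f : F ⟶ G) :
    ((totalFunctor k r).map (c • f)).lin = c • ((totalFunctor k r).map f).lin := rfl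

instance : (totalFunctor k r).Faithful where
  map_injective {F G f g} h := by
    refine ObjectProperty.hom_ext _ (NatTrans.ext (funext fun (i : ZMod r) ↦ ?_))
    refine FGModuleCat.hom_ext (LinearMap.ext fun (v : vertexSpace F.obj i) ↦ ?_)
    have h' : totalMap f.hom (Pi.single i v) i = totalMap g.hom (Pi.single i v) i :=
      congrArg (fun q ↦ q.lin (Pi.single i v) i) h
    simp only [totalMap, LinearMap.pi_apply, LinearMap.comp_apply, LinearMap.proj_apply,
      Pi.single_eq_same] at h'
    exact h'

/-- Linear maps at the vertices that commute with the arrow maps form a morphism of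
representations. -/
def homOfVertexMaps {F G : CyclicRep k r} (φ : ∀ i, vertexSpace F i →ₗ[k] vertexSpace G i)
    (hφ : ∀ i j h v, φ j (arrowMap F i j h v) = arrowMap G i j h (φ i v)) :
    F ⟶ G where
  app i := ObjectProperty.homMk (ModuleCat.ofHom (φ i))
  naturality a b p := by
    induction p using Paths.induction with
    | id => simp
    | @comp u i j p q hp =>
      have hq : F.map (cycArrow i j q.down) ≫ ObjectProperty.homMk (ModuleCat.ofHom (φ j)) =
          ObjectProperty.homMk (ModuleCat.ofHom (φ i)) ≫ G.map (cycArrow i j q.down) := by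
        ext v
        exact hφ i j q.down v
      calc
        _ = F.map p ≫ F.map (cycArrow i j q.down) ≫
              ObjectProperty.homMk (ModuleCat.ofHom (φ j)) := by
          rw [← Category.assoc, ← F.map_comp]; rfl
        _ = _ := by
          rw [hq, ← Category.assoc]
          exact (congrArg (· ≫ G.map (cycArrow i j q.down)) hp).trans
            ((Category.assoc _ _ _).trans (congrArg _ (G.map_comp _ _).symm))

instance : (totalFunctor k r).Full where
  map_surjective {F G} g := by
    have hg (v : ∀ i, vertexSpace F.obj i) (i : ZMod r) :
        g.lin v i = g.lin (Pi.single i (v i)) i := by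
      have := congrFun (g.lin_π i v) i
      exact ((congrFun (g.lin_π i v) i).trans (Pi.single_eq_same _ _)).symm
    let φ (i : ZMod r) : vertexSpace F.obj i →ₗ[k] vertexSpace G.obj i :=
      LinearMap.proj i ∘ₗ (g.lin : (∀ i, vertexSpace F.obj i) →ₗ[k] ∀ i, vertexSpace G.obj i) ∘ₗ
        LinearMap.single k (fun i ↦ (vertexSpace F.obj i : Type t)) i
    refine ⟨ObjectProperty.homMk (homOfVertexMaps φ fun i j h v ↦ ?_), ?_⟩
    · have h₁ := congrFun (g.lin_x (Pi.single i v)) j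
      have h₂ : totalArrow G.obj (g.lin (Pi.single i v)) j = arrowMap G.obj i j h (φ i v) :=
        totalArrow_apply G.obj _ i j h
      have h₃ : totalArrow F.obj (Pi.single i v) j = arrowMap F.obj i j h v := by
        rw [totalArrow_apply F.obj _ i j h, Pi.single_eq_same]
      rw [← h₂, ← h₃]
      exact (hg _ j).symm.trans h₁
    · ext v
      exact funext fun i ↦ (hg v i).symm

/-- The prefunctor of vertex spaces and arrow maps of a graded nilpotent module. -/
def gradedPrefunctor (A : CycMod k r) : CyclicQuiver r ⥤q FGModuleCat.{t} k where
  obj i := FGModuleCat.of k (LinearMap.range (A.π i))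
  map {i j} h := FGModuleCat.ofHom (A.x.restrict (by
    rintro _ ⟨v, rfl⟩
    obtain ⟨rfl⟩ := h
    exact ⟨A.x v, (A.x_π i v).symm⟩))

theorem gradedPrefunctor_lift_map (A : CycMod k r) {a b : CyclicQuiver r} (p : Quiver.Path a b)
    (v : LinearMap.range (A.π a)) :
    (((Paths.lift (gradedPrefunctor A)).map (X := (Paths.of (CyclicQuiver r)).obj a)
      (Y := (Paths.of (CyclicQuiver r)).obj b) p).hom.hom v : LinearMap.range (A.π b)).1 =
        (A.x ^ p.length) v.1 := by
  induction p with
  | nil => rfl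
  | cons p e ih =>
    rw [Quiver.Path.length_cons, pow_succ', Module.End.mul_apply, ← ih]
    rfl

instance : (totalFunctor k r).EssSurj where
  mem_essImage A := by
    obtain ⟨N, hN⟩ := A.nilpotent
    let F : NilpotentCyclicRep k r := ⟨Paths.lift (gradedPrefunctor A), N, fun a b p hp ↦ by
      ext v
      refine Subtype.ext ((gradedPrefunctor_lift_map A p v).trans ?_)
      rw [pow_eq_zero_of_le hp hN]
      rfl⟩
    have hcoe (i j : ZMod r) (m : LinearMap.range (A.π j)) :
        A.π i m.1 = if i = j then m.1 else 0 := by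
      obtain ⟨_, v, rfl⟩ := m
      rw [A.π_π]
      split_ifs with h
      · rw [h]
      · rfl
    let e : (∀ i, LinearMap.range (A.π i)) ≃ₗ[k] A.V :=
      { toFun := fun m ↦ ∑ i, (m i).1
        map_add' := by simp [Finset.sum_add_distrib]
        map_smul' := by simp [Finset.smul_sum]
        invFun := fun v i ↦ ⟨A.π i v, v, rfl⟩
        left_inv := fun m ↦ by
          ext i
          simp [hcoe]
        right_inv := A.sum_π }
    have he (m : ∀ i, LinearMap.range (A.π i)) : e m = ∑ i, (m i).1 := rfl
    have hπ (i : ZMod r) (m : ∀ i, LinearMap.range (A.π i)) : A.π i (e m) = (m i).1 := by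
      simp [he, hcoe]
    refine ⟨F, ⟨CycMod.isoOfLinearEquiv (A := totalSpace F) e (fun m ↦ ?_) fun i m ↦ ?_⟩⟩
    · refine (Finset.sum_congr rfl fun i _ ↦ ?_).trans (A.sum_π (A.x (e m)))
      have h₁ : i = i - 1 + 1 := by ring
      have h₂ : A.π i (A.x (e m)) = A.x (A.π (i - 1) (e m)) := by rw [A.x_π, ← h₁]
      refine Eq.trans ?_ (h₂.trans (congrArg A.x (hπ (i - 1) m))).symm
      exact (congrArg Subtype.val (totalArrow_apply F.obj m (i - 1) i h₁)).trans
        (gradedPrefunctor_lift_map A (Quiver.Hom.toPath ⟨h₁⟩) (m (i - 1)))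
    · refine Eq.trans ?_ (hπ i m).symm
      refine (Finset.sum_eq_single i (fun j _ hj ↦ ?_) (by simp)).trans ?_
      · exact congrArg Subtype.val (Pi.single_eq_of_ne (M := fun j ↦ vertexSpace F.obj j) hj (m i))
      · exact congrArg Subtype.val (Pi.single_eq_same (M := fun j ↦ vertexSpace F.obj j) i (m i))

end Total

/-! ### Exactness of the total space -/

namespace CycMod

variable {k : Type t} [Field k] {r : ℕ} [NeZero r]

/-- A graded submodule. -/
def sub (A : CycMod k r) (S : Submodule k A.V) (hx : ∀ v ∈ S, A.x v ∈ S)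
    (hπ : ∀ i, ∀ v ∈ S, A.π i v ∈ S) : CycMod k r where
  V := S
  x := A.x.restrict hx
  π i := (A.π i).restrict (hπ i)
  π_π i j v := by
    ext
    have := A.π_π i j v
    split_ifs at this ⊢ <;> simpa using this
  sum_π v := by
    ext
    simpa using A.sum_π v
  x_π i v := by
    ext
    exact A.x_π i v
  nilpotent := by
    obtain ⟨N, hN⟩ := A.nilpotent
    refine ⟨N, ?_⟩
    rw [Module.End.pow_restrict N]
    ext v
    simp [hN]

/-- The inclusion of a graded submodule. -/
def subι (A : CycMod k r) (S : Submodule k A.V) (hx : ∀ v ∈ S, A.x v ∈ S)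
    (hπ : ∀ i, ∀ v ∈ S, A.π i v ∈ S) : A.sub S hx hπ ⟶ A :=
  ⟨S.subtype, fun _ ↦ rfl, fun _ _ ↦ rfl⟩

theorem x_pow_π (A : CycMod k r) (n : ℕ) (i : ZMod r) (v : A.V) :
    (A.x ^ n) (A.π i v) = A.π (i + n) ((A.x ^ n) v) := by
  induction n with
  | zero => simp
  | succ n ih => rw [pow_succ', Module.End.mul_apply, Module.End.mul_apply, ih, A.x_π, add_assoc,
      Nat.cast_succ]

theorem lin_x_pow {A B : CycMod k r} (f : A ⟶ B) (n : ℕ) (v : A.V) :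
    f.lin ((A.x ^ n) v) = (B.x ^ n) (f.lin v) := by
  induction n with
  | zero => rfl
  | succ n ih => rw [pow_succ', pow_succ', Module.End.mul_apply, Module.End.mul_apply, f.lin_x, ih]

@[simp]
theorem hom_lin_inv_lin {A B : CycMod k r} (e : A ≅ B) (v : A.V) : e.inv.lin (e.hom.lin v) = v :=
  congrArg (fun q ↦ q.lin v) e.hom_inv_id

@[simp]
theorem inv_lin_hom_lin {A B : CycMod k r} (e : A ≅ B) (v : B.V) : e.hom.lin (e.inv.lin v) = v :=
  congrArg (fun q ↦ q.lin v) e.inv_hom_id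

end CycMod

/-- A fully faithful, essentially surjective and `k`-linear functor to graded nilpotent modules. -/
class IsTotalSpace {k : Type t} [Field k] {r : ℕ} [NeZero r] {T : Type u} [Category.{v} T]
    [Abelian T] [Linear k T] (Φ : T ⥤ CycMod k r) : Prop extends
    Φ.Full, Φ.Faithful, Φ.EssSurj where
  map_add_lin : ∀ {X Y : T} (f g : X ⟶ Y), (Φ.map (f + g)).lin = (Φ.map f).lin + (Φ.map g).lin
  map_smul_lin : ∀ {X Y : T} (c : k) (f : X ⟶ Y), (Φ.map (c • f)).lin = c • (Φ.map f).lin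

theorem IsTube.exists_isTotalSpace {k : Type t} [Field k] {r : ℕ} [NeZero r] {T : Type u}
    [Category.{v} T] [Abelian T] [Linear k T] (hT : IsTube k r T) :
    ∃ Φ : T ⥤ CycMod k r, IsTotalSpace Φ := by
  obtain ⟨-, e, hadd, hlin⟩ := hT
  refine ⟨e.functor ⋙ totalFunctor k r,
    { map_add_lin := fun f g ↦ ?_, map_smul_lin := fun c f ↦ ?_ }⟩
  · rw [Functor.comp_map, Functor.map_add, totalFunctor_map_add]; rfl
  · rw [Functor.comp_map, Functor.map_smul, totalFunctor_map_smul]; rfl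

section TotalSpace

variable {k : Type t} [Field k] {r : ℕ} [NeZero r] {T : Type u} [Category.{v} T]
    [Abelian T] [Linear k T] (Φ : T ⥤ CycMod k r) [IsTotalSpace Φ]

/-- The underlying linear map of a morphism of the tube. -/
def linMap (X Y : T) : (X ⟶ Y) →ₗ[k] ((Φ.obj X).V →ₗ[k] (Φ.obj Y).V) where
  toFun f := (Φ.map f).lin
  map_add' := IsTotalSpace.map_add_lin
  map_smul' := IsTotalSpace.map_smul_lin

variable {Φ}

theorem linMap_injective {X Y : T} : Function.Injective (linMap Φ X Y) :=
  fun _ _ h ↦ Φ.map_injective (CycMod.hom_ext h)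

theorem finite_hom (Φ : T ⥤ CycMod k r) [IsTotalSpace Φ] (X Y : T) : Module.Finite k (X ⟶ Y) :=
  Module.Finite.of_injective (linMap Φ X Y) linMap_injective

theorem linMap_comp {X Y Z : T} (f : X ⟶ Y) (g : Y ⟶ Z) (v : (Φ.obj X).V) :
    linMap Φ X Z (f ≫ g) v = linMap Φ Y Z g (linMap Φ X Y f v) :=
  congrArg (fun q ↦ q.lin v) (Φ.map_comp f g)

theorem linMap_id {X : T} (v : (Φ.obj X).V) : linMap Φ X X (𝟙 X) v = v :=
  congrArg (fun q ↦ q.lin v) (Φ.map_id X)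

theorem exists_linMap_eq {X Y : T} (g : Φ.obj X ⟶ Φ.obj Y) : ∃ f, linMap Φ X Y f = g.lin :=
  ⟨Φ.preimage g, congrArg CycMod.Hom.lin (Φ.map_preimage g)⟩

theorem linMap_x {X Y : T} (f : X ⟶ Y) (v : (Φ.obj X).V) :
    linMap Φ X Y f ((Φ.obj X).x v) = (Φ.obj Y).x (linMap Φ X Y f v) :=
  (Φ.map f).lin_x v

theorem linMap_x_pow {X Y : T} (f : X ⟶ Y) (n : ℕ) (v : (Φ.obj X).V) :
    linMap Φ X Y f (((Φ.obj X).x ^ n) v) = ((Φ.obj Y).x ^ n) (linMap Φ X Y f v) :=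
  CycMod.lin_x_pow (Φ.map f) n v

theorem linMap_π {X Y : T} (f : X ⟶ Y) (i : ZMod r) (v : (Φ.obj X).V) :
    linMap Φ X Y f ((Φ.obj X).π i v) = (Φ.obj Y).π i (linMap Φ X Y f v) :=
  (Φ.map f).lin_π i v

theorem mono_of_injective {X Y : T} (f : X ⟶ Y) (hf : Function.Injective (linMap Φ X Y f)) :
    Mono f :=
  ⟨fun g h e ↦ linMap_injective (Φ := Φ) (LinearMap.ext fun v ↦ hf (by
    rw [← linMap_comp, ← linMap_comp, e]))⟩

theorem epi_of_surjective {X Y : T} (f : X ⟶ Y) (hf : Function.Surjective (linMap Φ X Y f)) :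
    Epi f :=
  ⟨fun g h e ↦ linMap_injective (Φ := Φ) (LinearMap.ext fun v ↦ by
    obtain ⟨v, rfl⟩ := hf v
    rw [← linMap_comp, ← linMap_comp, e])⟩

/-- A graded submodule of the total space of an object is the total space of a subobject. -/
theorem exists_subobject {X : T} (S : Submodule k (Φ.obj X).V)
    (hx : ∀ v ∈ S, (Φ.obj X).x v ∈ S) (hπ : ∀ i, ∀ v ∈ S, (Φ.obj X).π i v ∈ S) :
    ∃ (K : T) (m : K ⟶ X), Function.Injective (linMap Φ K X m) ∧
      LinearMap.range (linMap Φ K X m) = S := by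
  let e := Φ.objObjPreimageIso ((Φ.obj X).sub S hx hπ)
  obtain ⟨m, hm⟩ := exists_linMap_eq (e.hom ≫ (Φ.obj X).subι S hx hπ)
  have hm' (v) : linMap Φ _ X m v = (e.hom.lin v).1 := congrArg (fun q ↦ q v) hm
  refine ⟨_, m, fun a b h ↦ ?_, le_antisymm ?_ fun v hv ↦ ?_⟩
  · rw [hm', hm'] at h
    rw [← CycMod.hom_lin_inv_lin e a, ← CycMod.hom_lin_inv_lin e b, Subtype.ext h]
  · rintro _ ⟨v, rfl⟩
    rw [hm']
    exact (e.hom.lin v).2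
  · exact ⟨e.inv.lin ⟨v, hv⟩,
      (hm' _).trans (congrArg Subtype.val (CycMod.inv_lin_hom_lin e ⟨v, hv⟩))⟩

theorem exists_kernel {X Y : T} (f : X ⟶ Y) :
    ∃ (K : T) (m : K ⟶ X), Function.Injective (linMap Φ K X m) ∧
      LinearMap.range (linMap Φ K X m) = LinearMap.ker (linMap Φ X Y f) := by
  refine exists_subobject _ (fun v hv ↦ ?_) fun i v hv ↦ ?_
  · rw [LinearMap.mem_ker] at hv ⊢
    rw [linMap_x, hv, map_zero]
  · rw [LinearMap.mem_ker] at hv ⊢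
    rw [linMap_π, hv, map_zero]

theorem comp_eq_zero_of_range_le {X Y Z : T} (f : X ⟶ Y) (g : Y ⟶ Z)
    (h : LinearMap.range (linMap Φ X Y f) ≤ LinearMap.ker (linMap Φ Y Z g)) : f ≫ g = 0 :=
  linMap_injective (Φ := Φ) (LinearMap.ext fun v ↦ by
    rw [linMap_comp, map_zero]
    exact h ⟨v, rfl⟩)

variable (Φ) in
theorem injective_of_mono {X Y : T} (f : X ⟶ Y) [Mono f] :
    Function.Injective (linMap Φ X Y f) := by
  obtain ⟨K, m, -, hm⟩ := exists_kernel (Φ := Φ) f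
  have : m = 0 := (cancel_mono f).1 (by rw [comp_eq_zero_of_range_le m f hm.le, Limits.zero_comp])
  rw [← LinearMap.ker_eq_bot, ← hm, this, map_zero, LinearMap.range_zero]

variable (Φ) in
theorem surjective_of_epi {X Y : T} (f : X ⟶ Y) [Epi f] :
    Function.Surjective (linMap Φ X Y f) := by
  -- `f` factors through its image, whose inclusion is a monomorphism and an epimorphism
  obtain ⟨I, m, hm, hI⟩ := exists_subobject (LinearMap.range (linMap Φ X Y f))
    (by rintro _ ⟨v, rfl⟩; exact ⟨_, linMap_x f v⟩)
    (by rintro i _ ⟨v, rfl⟩; exact ⟨_, linMap_π f i v⟩)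
  have := mono_of_injective m hm
  have hfac : Limits.cokernel.π m = 0 := by
    rw [← cancel_epi f, Limits.comp_zero]
    refine comp_eq_zero_of_range_le (Φ := Φ) _ _ (hI.ge.trans ?_)
    rintro _ ⟨v, rfl⟩
    rw [LinearMap.mem_ker, ← linMap_comp, Limits.cokernel.condition, map_zero]; rfl
  have : Epi m := Preadditive.epi_of_cokernel_zero hfac
  have : IsIso m := isIso_of_mono_of_epi m
  have hsurj : Function.Surjective (linMap Φ I Y m) := fun v ↦
    ⟨linMap Φ Y I (inv m) v, by rw [← linMap_comp, IsIso.inv_hom_id, linMap_id]⟩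
  rwa [← LinearMap.range_eq_top, hI, LinearMap.range_eq_top] at hsurj

variable (Φ) in
theorem exists_of_shortExact {S : ShortComplex T} (hS : S.ShortExact) (v : (Φ.obj S.X₂).V)
    (hv : linMap Φ _ _ S.g v = 0) : ∃ u, linMap Φ _ _ S.f u = v := by
  have := hS.mono_f
  obtain ⟨K, m, -, hm⟩ := exists_kernel (Φ := Φ) S.g
  have hmg : m ≫ S.g = 0 := comp_eq_zero_of_range_le m S.g hm.le
  obtain ⟨u, rfl⟩ : v ∈ LinearMap.range (linMap Φ K _ m) := hm ▸ hv
  exact ⟨linMap Φ _ _ (hS.exact.lift m hmg) u, by rw [← linMap_comp, hS.exact.lift_f]⟩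

end TotalSpace

/-! ### Induced modules and extensions -/

namespace CycMod

variable {k : Type t} [Field k] {r : ℕ} [NeZero r]

/-- The shift `(m₀, …, mₙ) ↦ (0, m₀, …, mₙ₋₁)`. -/
def shift (V : Type t) [AddCommGroup V] [Module k V] (n : ℕ) : Module.End k (Fin (n + 1) → V) :=
  LinearMap.pi (Fin.cons 0 fun s ↦ LinearMap.proj s.castSucc)

@[simp]
theorem shift_zero {V : Type t} [AddCommGroup V] [Module k V] {n : ℕ} (m : Fin (n + 1) → V) :
    shift (k := k) V n m 0 = 0 := rfl

@[simp]
theorem shift_succ {V : Type t} [AddCommGroup V] [Module k V] {n : ℕ} (m : Fin (n + 1) → V)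
    (s : Fin n) : shift (k := k) V n m s.succ = m s.castSucc := rfl

theorem shift_single {V : Type t} [AddCommGroup V] [Module k V] {n : ℕ} (a : V) (s : Fin n) :
    shift (k := k) V n (Pi.single s.castSucc a) = Pi.single s.succ a := by
  ext i
  induction i using Fin.cases with
  | zero => simp
  | succ i => rcases eq_or_ne i s with rfl | h <;> simp [*]

theorem shift_pow_apply_eq_zero {V : Type t} [AddCommGroup V] [Module k V] {n : ℕ} (s : ℕ)
    (m : Fin (n + 1) → V) (i : Fin (n + 1)) (hi : i.1 < s) :
    ((shift (k := k) V n) ^ s) m i = 0 := by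
  induction s generalizing i with
  | zero => omega
  | succ s ih =>
    rw [pow_succ', Module.End.mul_apply]
    induction i using Fin.cases with
    | zero => rfl
    | succ i => exact ih _ (by simpa using hi)

/-- The module `V ⊗ k[x]/(xⁿ⁺¹)`, which forgets the action of `x` on `V` and induces from the
underlying graded space of `V`. It is projective among the modules killed by `xⁿ⁺¹`. -/
def ind (n : ℕ) (A : CycMod k r) : CycMod k r where
  V := Fin (n + 1) → A.V
  x := shift A.V n
  π i := LinearMap.pi fun s ↦ A.π (i - s.1) ∘ₗ LinearMap.proj s
  π_π i j m := by
    ext s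
    have h := A.π_π (i - s.1) (j - s.1) (m s)
    simp only [sub_left_inj] at h
    split_ifs at h ⊢ <;> simpa using h
  sum_π m := by
    ext s
    simpa using ((Equiv.subRight (s.1 : ZMod r)).sum_comp fun i ↦ A.π i (m s)).trans (A.sum_π (m s))
  x_π i m := by
    ext s
    induction s using Fin.cases with
    | zero => simp
    | succ s => simp
  nilpotent := ⟨n + 1, LinearMap.ext fun m ↦ funext fun i ↦ shift_pow_apply_eq_zero _ _ _ i.2⟩

variable {n : ℕ} {A B : CycMod k r}

/-- The degree zero part of the induced module. -/
def indIncl (n : ℕ) (A : CycMod k r) : A.V →ₗ[k] (ind n A).V :=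
  LinearMap.single k (fun _ : Fin (n + 1) ↦ A.V) 0

theorem ind_x_pow_indIncl (s : ℕ) (hs : s < n + 1) (a : A.V) :
    ((ind n A).x ^ s) (indIncl n A a) = (Pi.single ⟨s, hs⟩ a : Fin (n + 1) → A.V) := by
  induction s with
  | zero => rfl
  | succ s ih =>
    rw [pow_succ', Module.End.mul_apply, ih (by omega)]
    exact shift_single a ⟨s, by omega⟩

theorem ind_π_indIncl (i : ZMod r) (a : A.V) :
    (ind n A).π i (indIncl n A a) = indIncl n A (A.π i a) := by
  refine funext fun (s : Fin (n + 1)) ↦ ?_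
  change A.π (i - s.1) ((Pi.single 0 a : Fin (n + 1) → A.V) s) =
    (Pi.single 0 (A.π i a) : Fin (n + 1) → A.V) s
  rcases eq_or_ne s 0 with rfl | h
  · simp
  · simp [h]

theorem ind_eq_sum (m : Fin (n + 1) → A.V) :
    m = ∑ s : Fin (n + 1), ((ind n A).x ^ s.1) (indIncl n A (m s)) := by
  conv_lhs => rw [← Finset.univ_sum_single m]
  exact Finset.sum_congr rfl fun s _ ↦ (ind_x_pow_indIncl s.1 s.2 (m s)).symm

/-- The linear map `m ↦ ∑ xˢ φ(mₛ)` on the total space of the induced module. -/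
def indLiftLin (n : ℕ) (φ : A.V →ₗ[k] B.V) : (Fin (n + 1) → A.V) →ₗ[k] B.V :=
  ∑ s : Fin (n + 1), (B.x ^ s.1) ∘ₗ φ ∘ₗ LinearMap.proj s

theorem indLiftLin_apply (φ : A.V →ₗ[k] B.V) (m : Fin (n + 1) → A.V) :
    indLiftLin n φ m = ∑ s : Fin (n + 1), (B.x ^ s.1) (φ (m s)) := by
  simp [indLiftLin]

theorem indLiftLin_shift (φ : A.V →ₗ[k] B.V) (hx : ∀ v, (B.x ^ (n + 1)) (φ v) = 0)
    (m : Fin (n + 1) → A.V) :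
    indLiftLin n φ (shift (k := k) A.V n m) = B.x (indLiftLin n φ m) := by
  rw [indLiftLin_apply, indLiftLin_apply, Fin.sum_univ_succ, Fin.sum_univ_castSucc, map_add,
    map_sum]
  simp_rw [← Module.End.mul_apply, ← pow_succ', Fin.val_last, hx]
  simp

/-- A homogeneous linear map `φ : A ⟶ B` whose image is killed by `xⁿ⁺¹` extends to the induced
module. -/
def indLift (φ : A.V →ₗ[k] B.V) (hφ : ∀ i v, φ (A.π i v) = B.π i (φ v))
    (hx : ∀ v, (B.x ^ (n + 1)) (φ v) = 0) : ind n A ⟶ B where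
  lin := indLiftLin n φ
  lin_x := indLiftLin_shift φ hx
  lin_π i (m : Fin (n + 1) → A.V) := by
    refine (indLiftLin_apply φ _).trans ((congrArg (B.π i) (indLiftLin_apply φ m)).trans ?_).symm
    rw [map_sum]
    refine Finset.sum_congr rfl fun s _ ↦ ?_
    have h : (ind n A).π i m s = A.π (i - s.1) (m s) := rfl
    rw [h, hφ, x_pow_π, sub_add_cancel]

theorem indLift_indIncl (φ : A.V →ₗ[k] B.V) (hφ : ∀ i v, φ (A.π i v) = B.π i (φ v))
    (hx : ∀ v, (B.x ^ (n + 1)) (φ v) = 0) (a : A.V) :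
    (indLift φ hφ hx).lin (indIncl n A a) = φ a := by
  refine (indLiftLin_apply φ _).trans ((Finset.sum_eq_single 0 (fun s _ hs ↦ ?_) (by simp)).trans
    (congrArg φ (Pi.single_eq_same (M := fun _ : Fin (n + 1) ↦ A.V) (0 : Fin (n + 1)) a)))
  have h : indIncl n A a s = 0 := Pi.single_eq_of_ne (M := fun _ : Fin (n + 1) ↦ A.V) hs a
  rw [h, map_zero, map_zero]

theorem ind_hom_ext {f g : ind n A ⟶ B}
    (h : ∀ a, f.lin (indIncl n A a) = g.lin (indIncl n A a)) : f = g := by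
  refine hom_ext (LinearMap.ext fun (m : Fin (n + 1) → A.V) ↦ ?_)
  rw [ind_eq_sum m, map_sum, map_sum]
  exact Finset.sum_congr rfl fun s _ ↦ by rw [lin_x_pow, lin_x_pow, h]

/-- Induced modules lift along surjections from modules killed by `xⁿ⁺¹`. -/
theorem ind_lift {C : CycMod k r} (f : ind n A ⟶ B) (g : C ⟶ B) (hg : Function.Surjective g.lin)
    (hC : C.x ^ (n + 1) = 0) : ∃ f' : ind n A ⟶ C, f' ≫ g = f := by
  obtain ⟨s, hs⟩ := g.lin.exists_rightInverse_of_surjective (LinearMap.range_eq_top.2 hg)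
  have hs' (v) : g.lin (s v) = v := congrArg (fun q ↦ q v) hs
  -- the linear section `s`, made homogeneous
  refine ⟨indLift (∑ i, C.π i ∘ₗ s ∘ₗ f.lin ∘ₗ indIncl n A ∘ₗ A.π i) (fun j v ↦ ?_) fun v ↦ ?_,
    ind_hom_ext fun a ↦ ?_⟩
  · simp only [LinearMap.sum_apply, LinearMap.comp_apply, map_sum, A.π_π, C.π_π]
    simp [apply_ite]
  · rw [hC, LinearMap.zero_apply]
  · rw [comp_lin, LinearMap.comp_apply, indLift_indIncl]
    simp only [LinearMap.sum_apply, LinearMap.comp_apply, map_sum, g.lin_π, hs', ← f.lin_π,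
      ind_π_indIncl, A.π_π, if_true]
    rw [← map_sum, ← map_sum, A.sum_π]

end CycMod

section Cover

variable {k : Type t} [Field k] {r : ℕ} [NeZero r] {T : Type u} [Category.{v} T]
    [Abelian T] [Linear k T] {Φ : T ⥤ CycMod k r} [IsTotalSpace Φ]

/-- A surjection from an induced module to the total space of `X` comes from an epimorphism. -/
theorem exists_cover {X : T} {n : ℕ} {A : CycMod k r} (φ : A.ind n ⟶ Φ.obj X)
    (hφ : Function.Surjective φ.lin) :
    ∃ (P : T) (p : P ⟶ X) (e : Φ.obj P ≅ A.ind n), Epi p ∧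
      ∀ m, linMap Φ P X p m = φ.lin (e.hom.lin m) := by
  let e := Φ.objObjPreimageIso (A.ind n)
  obtain ⟨p, hp⟩ := exists_linMap_eq (Φ := Φ) (e.hom ≫ φ)
  have hp' (m) : linMap Φ _ X p m = φ.lin (e.hom.lin m) := congrArg (fun q ↦ q m) hp
  refine ⟨_, p, e, epi_of_surjective (Φ := Φ) p fun y ↦ ?_, hp'⟩
  obtain ⟨m, rfl⟩ := hφ y
  exact ⟨e.inv.lin m, by rw [hp', CycMod.inv_lin_hom_lin]⟩

/-- Induced modules compute `Ext¹`: an extension of `S.X₃` by `Y` is killed by `xⁿ⁺¹`, so the map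
from the induced module `S.X₂` to `S.X₃` lifts to it, and the class of the extension comes from
`Hom(S.X₁, Y)`. -/
theorem connectingMap_surjective [HasExt.{w} T] {S : ShortComplex T} (hS : S.ShortExact) {Y : T}
    {n n₁ n₂ : ℕ} {A : CycMod k r} (e : Φ.obj S.X₂ ≅ A.ind n)
    (h₁ : (Φ.obj S.X₃).x ^ n₁ = 0) (h₂ : (Φ.obj Y).x ^ n₂ = 0) (hn : n₁ + n₂ ≤ n + 1) :
    Function.Surjective (connectingMap.{w} k hS Y) := by
  intro α
  refine exists_connectingMap_eq hS α ?_
  obtain ⟨E, f, g, h, hE, hα⟩ := exists_shortExact_mk₀_comp_eq_zero α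
  have hEx : (Φ.obj E).x ^ (n + 1) = 0 := by
    refine pow_eq_zero_of_le hn (LinearMap.ext fun y ↦ ?_)
    obtain ⟨u, hu⟩ : ∃ u, linMap Φ Y E f u = ((Φ.obj E).x ^ n₁) y := exists_of_shortExact Φ hE _
      (by erw [linMap_x_pow, h₁, LinearMap.zero_apply])
    rw [add_comm, pow_add, Module.End.mul_apply, ← hu, ← linMap_x_pow, h₂]
    simp
  have := hE.epi_g
  obtain ⟨q, hq⟩ := CycMod.ind_lift (e.inv ≫ Φ.map S.g) (Φ.map g) (surjective_of_epi Φ g) hEx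
  have hfac : Φ.preimage (e.hom ≫ q) ≫ g = S.g := Φ.map_injective (by simp [hq])
  rw [← hfac, ← Ext.mk₀_comp_mk₀_assoc, hα, Ext.comp_zero]

theorem finite_ext (Φ : T ⥤ CycMod k r) [IsTotalSpace Φ] [HasExt.{w} T] (X Y : T) :
    Module.Finite k (Ext.{w} X Y 1) := by
  obtain ⟨n₁, h₁⟩ := (Φ.obj X).nilpotent
  obtain ⟨n₂, h₂⟩ := (Φ.obj Y).nilpotent
  have hx (y : (Φ.obj X).V) : ((Φ.obj X).x ^ (n₁ + n₂ + 1)) (LinearMap.id (R := k) y) = 0 := by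
    rw [pow_eq_zero_of_le (by omega) h₁, LinearMap.zero_apply]
  obtain ⟨P, p, e, hp, -⟩ := exists_cover (CycMod.indLift (n := n₁ + n₂) LinearMap.id
    (fun _ _ ↦ rfl) hx) fun y ↦ ⟨_, CycMod.indLift_indIncl LinearMap.id (fun _ _ ↦ rfl) hx y⟩
  have hS : (ShortComplex.mk (Limits.kernel.ι p) p (Limits.kernel.condition p)).ShortExact :=
    { exact := ShortComplex.exact_kernel p }
  have := finite_hom Φ (Limits.kernel p) Y
  exact Module.Finite.of_surjective (connectingMap.{w} k hS Y)
    (connectingMap_surjective hS e h₁ h₂ (by omega))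

end Cover

/-! ### Uniserial modules and bricks -/

namespace CycMod

theorem natCast_inj {r s s' : ℕ} (hs : s < r) (hs' : s' < r) (h : (s : ZMod r) = s') : s = s' :=
  ((ZMod.natCast_eq_natCast_iff _ _ _).1 h).eq_of_lt_of_lt hs hs'

variable {k : Type t} [Field k] {r : ℕ} [NeZero r]

/-- The simple module at the vertex `a`. -/
def simple (k : Type t) [Field k] (a : ZMod r) : CycMod k r where
  V := k
  x := 0
  π i := if i = a then 1 else 0
  π_π i j v := by split_ifs <;> simp_all
  sum_π v := by
    rw [← LinearMap.sum_apply]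
    simp
  x_π i v := by simp
  nilpotent := ⟨1, by simp⟩

theorem simple_π (a i : ZMod r) (c : k) :
    (simple k a).π i c = if i = a then c else 0 := by
  change (if i = a then (1 : Module.End k k) else 0) c = _
  split_ifs <;> rfl

/-- The module `A` is uniserial of length `N + 1`, with top at the vertex `a`: it has the basis
`v, x v, …, xᴺ v` with `v` homogeneous of degree `a`. The linear form `l` reads off the
coefficient at `xᴺ v`, so that `l (xᴺ⁻ˢ w)` is the coefficient of `w` at `xˢ v`. -/
structure IsUniserial (A : CycMod k r) (a : ZMod r) (N : ℕ) (v : A.V) (l : A.V →ₗ[k] k) :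
    Prop where
  π_gen : A.π a v = v
  x_pow : A.x ^ (N + 1) = 0
  l_π : ∀ i w, l (A.π i w) = if i = a + N then l w else 0
  l_x_pow : ∀ s, l ((A.x ^ s) v) = if s = N then 1 else 0
  eq_sum : ∀ w, w = ∑ s ∈ Finset.range (N + 1), l ((A.x ^ (N - s)) w) • (A.x ^ s) v

variable {A B : CycMod k r}

theorem π_x_pow {a : ZMod r} {y : A.V} (hy : A.π a y = y) (s : ℕ) (i : ZMod r) :
    A.π i ((A.x ^ s) y) = if i = a + s then (A.x ^ s) y else 0 := by
  have h : A.π (a + s) ((A.x ^ s) y) = (A.x ^ s) y := by rw [← x_pow_π, hy]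
  rw [← h, A.π_π]
  split_ifs with h'
  · rw [h']
  · rfl

/-- If the linear form `l` is homogeneous of degree `a + N` and `A` is killed by `xᴺ⁺¹`, then an
element `y` of degree `a` killed by `xᴺ⁺¹` defines a morphism. -/
def homOfForm {a : ZMod r} {N : ℕ} {l : A.V →ₗ[k] k} (hA : A.x ^ (N + 1) = 0)
    (hl : ∀ i w, l (A.π i w) = if i = a + N then l w else 0) {y : B.V} (hy : B.π a y = y)
    (hxy : (B.x ^ (N + 1)) y = 0) : A ⟶ B where
  lin := ∑ s ∈ Finset.range (N + 1), (l ∘ₗ (A.x ^ (N - s))).smulRight ((B.x ^ s) y)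
  lin_x w := by
    simp only [LinearMap.sum_apply, LinearMap.smulRight_apply, LinearMap.comp_apply, map_sum,
      map_smul, ← Module.End.mul_apply, ← pow_succ, ← pow_succ']
    rw [Finset.sum_range_succ', Finset.sum_range_succ (fun s ↦ _ • (B.x ^ (s + 1)) y), hxy]
    simp only [Nat.sub_zero, hA, LinearMap.zero_apply, map_zero, zero_smul, smul_zero]
    congr 1
    refine Finset.sum_congr rfl fun s hs ↦ ?_
    rw [Finset.mem_range] at hs
    rw [show N - (s + 1) + 1 = N - s by omega]
  lin_π i w := by
    simp only [LinearMap.sum_apply, LinearMap.smulRight_apply, LinearMap.comp_apply, map_sum,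
      map_smul]
    refine Finset.sum_congr rfl fun s hs ↦ ?_
    rw [Finset.mem_range] at hs
    rw [x_pow_π, hl, π_x_pow hy]
    have : i + (N - s : ℕ) = a + N ↔ i = a + s := by
      rw [Nat.cast_sub (by omega)]
      constructor <;> intro h <;> linear_combination h
    simp only [this]
    split_ifs <;> simp

theorem homOfForm_apply {a : ZMod r} {N : ℕ} {l : A.V →ₗ[k] k} (hA : A.x ^ (N + 1) = 0)
    (hl : ∀ i w, l (A.π i w) = if i = a + N then l w else 0) {y : B.V} (hy : B.π a y = y)
    (hxy : (B.x ^ (N + 1)) y = 0) (w : A.V) : (homOfForm hA hl hy hxy).lin w =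
      ∑ s ∈ Finset.range (N + 1), l ((A.x ^ (N - s)) w) • (B.x ^ s) y := by
  simp [homOfForm]

/-- The form `l` sees only the top power of `x`, for reasons of degree. -/
theorem form_x_pow {a : ZMod r} {N : ℕ} {v : A.V} {l : A.V →ₗ[k] k} (hA : A.x ^ (N + 1) = 0)
    (hl : ∀ i w, l (A.π i w) = if i = a + N then l w else 0) (hv : A.π a v = v)
    (hlv : l ((A.x ^ N) v) = 1) (hN : N < r) (s : ℕ) :
    l ((A.x ^ s) v) = if s = N then 1 else 0 := by
  split_ifs with h
  · rw [h, hlv]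
  rcases lt_or_gt_of_ne h with h | h
  · rw [← hv, x_pow_π, hl, if_neg]
    intro h'
    exact h.ne (natCast_inj (h.trans hN) hN (add_left_cancel h'))
  · rw [pow_eq_zero_of_le h hA]
    simp

theorem homOfForm_gen {a : ZMod r} {N : ℕ} {v : A.V} {l : A.V →ₗ[k] k} (hA : A.x ^ (N + 1) = 0)
    (hl : ∀ i w, l (A.π i w) = if i = a + N then l w else 0)
    (hlv : ∀ s, l ((A.x ^ s) v) = if s = N then 1 else 0) {y : B.V} (hy : B.π a y = y)
    (hxy : (B.x ^ (N + 1)) y = 0) : (homOfForm hA hl hy hxy).lin v = y := by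
  rw [homOfForm_apply, Finset.sum_eq_single 0]
  · simp [hlv]
  · intro s hs hs0
    rw [Finset.mem_range] at hs
    rw [hlv, if_neg (by omega), zero_smul]
  · simp

/-- A brick is uniserial of length at most `r`. The power `xʳ` is a nilpotent endomorphism, hence
zero. A homogeneous element `v` that survives the highest nonzero power of `x` generates a direct
summand, the projection to which has to be the identity. -/
theorem exists_isUniserial [Nontrivial A.V] (hA : ∀ f : A ⟶ A, ∃ c : k, ∀ w, f.lin w = c • w) :
    ∃ a N v l, N < r ∧ A.IsUniserial a N v l := by
  have hr : A.x ^ r = 0 := by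
    obtain ⟨c, hc⟩ := hA ⟨A.x ^ r, fun v ↦ by
      rw [← Module.End.mul_apply, ← Module.End.mul_apply, ← pow_succ, ← pow_succ'],
      fun i v ↦ by simp [x_pow_π]⟩
    obtain ⟨M, hM⟩ := A.nilpotent
    have hc' : A.x ^ r = c • LinearMap.id := LinearMap.ext hc
    obtain ⟨w, hw⟩ := exists_ne (0 : A.V)
    have hpow (m : ℕ) : ((A.x ^ r) ^ m) w = c ^ m • w := by
      induction m with
      | zero => simp
      | succ m ih =>
        rw [pow_succ', Module.End.mul_apply, ih, hc', LinearMap.smul_apply, LinearMap.id_apply,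
          smul_smul, ← pow_succ']
    have : c = 0 := by
      have h0 := hpow M
      rw [← pow_mul, mul_comm, pow_mul, hM, zero_pow (NeZero.ne r), LinearMap.zero_apply] at h0
      exact eq_zero_of_pow_eq_zero ((smul_eq_zero.1 h0.symm).resolve_right hw)
    rw [hc', this, zero_smul]
  classical
  have hex : ∃ m, A.x ^ m = 0 := ⟨r, hr⟩
  obtain ⟨N, hN⟩ : ∃ N, Nat.find hex = N + 1 := Nat.exists_eq_succ_of_ne_zero fun h ↦ by
    obtain ⟨w, hw⟩ := exists_ne (0 : A.V)
    have := Nat.find_spec hex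
    rw [h, pow_zero] at this
    exact hw (congrArg (fun q ↦ q w) this)
  have hx : A.x ^ (N + 1) = 0 := hN ▸ Nat.find_spec hex
  have hxN : A.x ^ N ≠ 0 := Nat.find_min hex (by omega)
  have hlt : N < r := by
    have := Nat.find_min' hex hr
    omega
  obtain ⟨a, v, hv, hxv⟩ : ∃ a v, A.π a v = v ∧ (A.x ^ N) v ≠ 0 := by
    by_contra! h
    refine hxN (LinearMap.ext fun w ↦ ?_)
    rw [← A.sum_π w, map_sum]
    exact Finset.sum_eq_zero fun i _ ↦ h i _ (by rw [A.π_π, if_pos rfl])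
  obtain ⟨l₀, hl₀⟩ : ∃ l₀ : A.V →ₗ[k] k, l₀ ((A.x ^ N) v) = 1 := by
    obtain ⟨l₁, h₁⟩ := not_forall.1 (mt (Module.forall_dual_apply_eq_zero_iff k _).1 hxv)
    exact ⟨(l₁ ((A.x ^ N) v))⁻¹ • l₁, inv_mul_cancel₀ h₁⟩
  have hl (i w) : (l₀ ∘ₗ A.π (a + N)) (A.π i w) =
      if i = a + N then (l₀ ∘ₗ A.π (a + N)) w else 0 := by
    rw [LinearMap.comp_apply, A.π_π, LinearMap.comp_apply]
    simp only [eq_comm (a := i)]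
    split_ifs <;> simp
  have hlv := form_x_pow hx hl hv
    (by rw [LinearMap.comp_apply, ← x_pow_π, hv, hl₀] : (l₀ ∘ₗ A.π (a + N)) ((A.x ^ N) v) = 1) hlt
  have hxv' : (A.x ^ (N + 1)) v = 0 := by rw [hx, LinearMap.zero_apply]
  refine ⟨a, N, v, l₀ ∘ₗ A.π (a + N), hlt, hv, hx, hl, hlv, fun w ↦ ?_⟩
  obtain ⟨c, hc⟩ := hA (homOfForm hx hl hv hxv')
  have hc1 : c = 1 := by
    have h := homOfForm_gen hx hl hlv hv hxv'
    rw [hc] at h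
    have hv0 : v ≠ 0 := fun h0 ↦ hxv (by rw [h0, map_zero])
    exact smul_left_injective k hv0 (by simpa using h)
  rw [← homOfForm_apply hx hl hv hxv', hc, hc1, one_smul]

namespace IsUniserial

variable {a : ZMod r} {N : ℕ} {v : A.V} {l : A.V →ₗ[k] k}

theorem of_span (hv : A.π a v = v) (hx : A.x ^ (N + 1) = 0)
    (hl : ∀ i w, l (A.π i w) = if i = a + N then l w else 0)
    (hlv : ∀ s, l ((A.x ^ s) v) = if s = N then 1 else 0)
    (h : ∀ w, ∃ c : ℕ → k, w = ∑ s ∈ Finset.range (N + 1), c s • (A.x ^ s) v) :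
    A.IsUniserial a N v l where
  π_gen := hv
  x_pow := hx
  l_π := hl
  l_x_pow := hlv
  eq_sum w := by
    obtain ⟨c, hc⟩ := h w
    conv_lhs => rw [hc]
    refine Finset.sum_congr rfl fun s hs ↦ ?_
    rw [hc, map_sum, map_sum, Finset.sum_eq_single s]
    · rw [map_smul, map_smul, ← Module.End.mul_apply, ← pow_add, hlv, if_pos, smul_eq_mul, mul_one]
      rw [Finset.mem_range] at hs
      omega
    · intro s' hs' hne
      rw [map_smul, map_smul, ← Module.End.mul_apply, ← pow_add, hlv, if_neg, smul_zero]
      rw [Finset.mem_range] at hs hs'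
      omega
    · exact fun h ↦ absurd hs h

theorem x_pow_gen_ne_zero (hA : A.IsUniserial a N v l) {s : ℕ} (hs : s ≤ N) :
    (A.x ^ s) v ≠ 0 := by
  intro h
  have h' := hA.l_x_pow N
  rw [if_pos rfl, ← Nat.sub_add_cancel hs, pow_add, Module.End.mul_apply, h, map_zero,
    map_zero] at h'
  exact zero_ne_one h'

theorem exists_hom (hA : A.IsUniserial a N v l) {y : B.V} (hy : B.π a y = y)
    (hxy : (B.x ^ (N + 1)) y = 0) : ∃ f : A ⟶ B, f.lin v = y :=
  ⟨homOfForm hA.x_pow hA.l_π hy hxy, homOfForm_gen hA.x_pow hA.l_π hA.l_x_pow hy hxy⟩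

theorem hom_ext (hA : A.IsUniserial a N v l) {f g : A ⟶ B} (h : f.lin v = g.lin v) : f = g := by
  refine CycMod.hom_ext (LinearMap.ext fun w ↦ ?_)
  rw [hA.eq_sum w]
  simp only [map_sum, map_smul, lin_x_pow, h]

theorem of_iso (hA : A.IsUniserial a N v l) (e : B ≅ A) :
    B.IsUniserial a N (e.inv.lin v) (l ∘ₗ e.hom.lin) where
  π_gen := by rw [← e.inv.lin_π, hA.π_gen]
  x_pow := LinearMap.ext fun w ↦ by
    rw [← hom_lin_inv_lin e w, ← lin_x_pow, hA.x_pow]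
    simp
  l_π i w := by simp only [LinearMap.comp_apply, e.hom.lin_π, hA.l_π]
  l_x_pow s := by rw [← lin_x_pow, LinearMap.comp_apply, inv_lin_hom_lin, hA.l_x_pow]
  eq_sum w := by
    conv_lhs => rw [← hom_lin_inv_lin e w, hA.eq_sum (e.hom.lin w)]
    simp only [map_sum, map_smul, lin_x_pow, LinearMap.comp_apply]

/-- The homogeneous components of a uniserial module of length at most `r` have dimension at most
one. -/
theorem eq_smul_of_homogeneous (hA : A.IsUniserial a N v l) (hN : N < r) {i : ZMod r} {y : A.V}
    (hy : A.π i y = y) (hy0 : y ≠ 0) : ∃ s ≤ N, a + s = i ∧ ∃ c : k, y = c • (A.x ^ s) v := by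
  have key (s : ℕ) (hs : s ∈ Finset.range (N + 1)) (h : a + s ≠ i) :
      l ((A.x ^ (N - s)) y) • (A.x ^ s) v = 0 := by
    rw [Finset.mem_range] at hs
    rw [← hy, x_pow_π, hA.l_π, if_neg, zero_smul]
    rw [Nat.cast_sub (by omega)]
    intro h'
    exact h (by linear_combination -h')
  by_cases h : ∃ s ≤ N, a + s = i
  · obtain ⟨s, hs, rfl⟩ := h
    refine ⟨s, hs, rfl, _, (hA.eq_sum y).trans (Finset.sum_eq_single s (fun s' hs' hne ↦
      key s' hs' fun h ↦ hne ?_) fun hs' ↦ ?_)⟩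
    · rw [Finset.mem_range] at hs'
      exact natCast_inj (by omega) (by omega) (add_left_cancel h)
    · exact absurd (Finset.mem_range.2 (by omega)) hs'
  · push Not at h
    refine absurd ((hA.eq_sum y).trans (Finset.sum_eq_zero fun s hs ↦ key s hs (h s ?_))) hy0
    rw [Finset.mem_range] at hs
    omega

end IsUniserial

theorem ind_x_pow (n : ℕ) (A : CycMod k r) : (ind n A).x ^ (n + 1) = 0 :=
  LinearMap.ext fun m ↦ funext fun i ↦ shift_pow_apply_eq_zero _ m i i.2

/-- The basis vector of the simple module. -/
def simpleGen (k : Type t) [Field k] (a : ZMod r) : (simple k a).V := (1 : k)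

/-- The generator of the module induced from a simple module. -/
def indGen (k : Type t) [Field k] (n : ℕ) (a : ZMod r) : (ind n (simple k a)).V :=
  indIncl n (simple k a) (simpleGen k a)

theorem simple_π_simpleGen (a : ZMod r) : (simple k a).π a (simpleGen k a) = simpleGen k a :=
  (simple_π a a (1 : k)).trans (if_pos rfl)

theorem isUniserial_simple (a : ZMod r) :
    (simple k a).IsUniserial a 0 (simpleGen k a) (LinearMap.id (R := k) (M := k)) := by
  have hx : (simple k a).x = 0 := rfl
  refine IsUniserial.of_span (simple_π_simpleGen a) (by rw [hx, zero_add, pow_one])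
    (fun i (c : k) ↦ ?_) (fun s ↦ ?_) fun (c : k) ↦ ⟨fun _ ↦ c, ?_⟩
  · rw [Nat.cast_zero, add_zero]
    exact simple_π a i c
  · split_ifs with h
    · subst h
      rfl
    · rw [hx, zero_pow h]
      rfl
  · rw [zero_add, Finset.sum_range_one]
    exact (mul_one c).symm

/-- The module induced from a simple module is uniserial. -/
theorem isUniserial_ind_simple (n : ℕ) (a : ZMod r) :
    (ind n (simple k a)).IsUniserial a n (indGen k n a)
      (LinearMap.proj (R := k) (φ := fun _ : Fin (n + 1) ↦ k) (Fin.last n)) := by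
  refine IsUniserial.of_span ?_ (ind_x_pow n _) (fun i m ↦ ?_) (fun s ↦ ?_)
    fun (m : Fin (n + 1) → k) ↦ ?_
  · rw [indGen, ind_π_indIncl, simple_π_simpleGen]
  · refine (simple_π a (i - n) _).trans ?_
    simp only [sub_eq_iff_eq_add]
    rfl
  · rcases lt_or_ge s (n + 1) with hs | hs
    · refine (congrFun (ind_x_pow_indIncl s hs (simpleGen k a)) (Fin.last n)).trans ?_
      split_ifs with h
      · subst h
        exact Pi.single_eq_same (M := fun _ ↦ k) (Fin.last s) (1 : k)
      · exact Pi.single_eq_of_ne (M := fun _ ↦ k) (Fin.ne_of_val_ne (Ne.symm h)) (1 : k)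
    · rw [pow_eq_zero_of_le hs (ind_x_pow n _), if_neg (by omega)]
      rfl
  · refine ⟨fun s ↦ if h : s < n + 1 then m ⟨s, h⟩ else 0, ?_⟩
    refine (ind_eq_sum (A := simple k a) m).trans ?_
    rw [Finset.sum_range]
    refine Finset.sum_congr rfl fun s _ ↦ ?_
    simp only [s.2, dif_pos]
    rw [indGen, ← map_smul, ← map_smul]
    exact congrArg (fun q ↦ ((ind n (simple k a)).x ^ s.1) (indIncl n (simple k a) q))
      (mul_one (m s)).symm

end CycMod

/-! ### Extensions between uniserial objects -/

section UniserialExt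

variable {k : Type t} [Field k] {r : ℕ} [NeZero r] {T : Type u} [Category.{v} T]
    [Abelian T] [Linear k T] {Φ : T ⥤ CycMod k r} [IsTotalSpace Φ]

open CycMod

/-- The kernel of a surjection between uniserial objects with the same top is uniserial. -/
theorem isUniserial_kernel {K P X : T} {a : ZMod r} {N m : ℕ} {v : (Φ.obj X).V}
    {l : (Φ.obj X).V →ₗ[k] k} {ε : (Φ.obj P).V} {L : (Φ.obj P).V →ₗ[k] k}
    (hX : (Φ.obj X).IsUniserial a N v l) (hP : (Φ.obj P).IsUniserial a (N + 1 + m) ε L)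
    {i : K ⟶ P} {p : P ⟶ X} (hi : Function.Injective (linMap Φ K P i)) (hip : i ≫ p = 0)
    (hp : linMap Φ P X p ε = v) {κ : (Φ.obj K).V}
    (hκ : linMap Φ K P i κ = ((Φ.obj P).x ^ (N + 1)) ε) :
    (Φ.obj K).IsUniserial (a + N + 1) m κ (L ∘ₗ linMap Φ K P i) := by
  have hker (z : (Φ.obj K).V) (t : ℕ) (ht : t ∈ Finset.range (N + 1)) :
      L (((Φ.obj P).x ^ (N + 1 + m - t)) (linMap Φ K P i z)) = 0 := by
    rw [Finset.mem_range] at ht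
    have h : l (((Φ.obj X).x ^ (N - t)) (linMap Φ P X p (linMap Φ K P i z))) = 0 := by
      rw [← linMap_comp, hip, map_zero, LinearMap.zero_apply, map_zero, map_zero]
    rw [hP.eq_sum (linMap Φ K P i z), map_sum, map_sum, map_sum, Finset.sum_eq_single t] at h
    · rwa [map_smul, map_smul, map_smul, linMap_x_pow, hp, ← Module.End.mul_apply, ← pow_add,
        hX.l_x_pow, if_pos (by omega), smul_eq_mul, mul_one] at h
    · intro s _ hst
      rw [map_smul, map_smul, map_smul, linMap_x_pow, hp, ← Module.End.mul_apply, ← pow_add,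
        hX.l_x_pow, if_neg (by omega), smul_zero]
    · intro h
      exact absurd (Finset.mem_range.2 (by omega)) h
  have hspan (z : (Φ.obj K).V) : z = ∑ s ∈ Finset.range (m + 1),
      L (((Φ.obj P).x ^ (N + 1 + m - (N + 1 + s))) (linMap Φ K P i z)) •
        ((Φ.obj K).x ^ s) κ := by
    refine hi ((hP.eq_sum (linMap Φ K P i z)).trans ?_)
    rw [add_assoc (N + 1), Finset.sum_range_add, Finset.sum_eq_zero fun t ht ↦ by
      rw [hker z t ht, zero_smul], zero_add, map_sum]
    refine Finset.sum_congr rfl fun s _ ↦ ?_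
    rw [map_smul, linMap_x_pow, hκ, ← Module.End.mul_apply, ← pow_add, add_comm s]
  refine IsUniserial.of_span (hi ?_) (LinearMap.ext fun z ↦ hi ?_) (fun j z ↦ ?_) (fun s ↦ ?_)
    fun z ↦ ⟨_, hspan z⟩
  · rw [linMap_π, hκ, π_x_pow hP.π_gen, if_pos (by push_cast; ring)]
  · rw [LinearMap.zero_apply, map_zero, hspan z, map_sum, map_sum]
    refine Finset.sum_eq_zero fun s _ ↦ ?_
    have h0 : (Φ.obj P).x ^ (m + 1 + s + (N + 1)) = 0 := pow_eq_zero_of_le (by omega) hP.x_pow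
    rw [map_smul, map_smul, ← Module.End.mul_apply, ← pow_add, linMap_x_pow, hκ,
      ← Module.End.mul_apply, ← pow_add, h0, LinearMap.zero_apply, smul_zero]
  · rw [LinearMap.comp_apply, linMap_π, hP.l_π]
    push_cast
    simp only [add_assoc]
    rfl
  · rw [LinearMap.comp_apply, linMap_x_pow, hκ, ← Module.End.mul_apply, ← pow_add, hP.l_x_pow]
    simp only [add_comm s, add_right_inj]

/-- The presentation `0 ⟶ K ⟶ P ⟶ X ⟶ 0` of a uniserial object `X` of length `N + 1` by the
uniserial object `P` of length `N + m + 2` with the same top. It computes `Ext¹(X, Y)` as soon as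
`Y` is killed by `xᵐ⁺¹`. -/
theorem exists_presentation [HasExt.{w} T] {X : T} {a : ZMod r} {N : ℕ} {v : (Φ.obj X).V}
    {l : (Φ.obj X).V →ₗ[k] k} (hX : (Φ.obj X).IsUniserial a N v l) (m : ℕ) :
    ∃ (K P : T) (i : K ⟶ P) (p : P ⟶ X) (hip : i ≫ p = 0)
      (hS : (ShortComplex.mk i p hip).ShortExact) (ε : (Φ.obj P).V) (κ : (Φ.obj K).V)
      (L : (Φ.obj P).V →ₗ[k] k) (L' : (Φ.obj K).V →ₗ[k] k),
      (Φ.obj P).IsUniserial a (N + 1 + m) ε L ∧ (Φ.obj K).IsUniserial (a + N + 1) m κ L' ∧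
      linMap Φ K P i κ = ((Φ.obj P).x ^ (N + 1)) ε ∧
      ∀ Y : T, (Φ.obj Y).x ^ (m + 1) = 0 → Function.Surjective (connectingMap.{w} k hS Y) := by
  have hI := isUniserial_ind_simple (k := k) (N + 1 + m) a
  obtain ⟨φ, hφ⟩ := hI.exists_hom hX.π_gen
    (by rw [pow_eq_zero_of_le (by omega) hX.x_pow, LinearMap.zero_apply])
  obtain ⟨P, p, e, hp, hpe⟩ := exists_cover φ fun y ↦ by
    rw [hX.eq_sum y]
    refine ⟨∑ s ∈ Finset.range (N + 1), l (((Φ.obj X).x ^ (N - s)) y) •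
      ((ind (N + 1 + m) (simple k a)).x ^ s) (indGen k (N + 1 + m) a), ?_⟩
    simp only [map_sum, map_smul, lin_x_pow, hφ]
  have hP := hI.of_iso e
  have hpε := hpe (e.inv.lin (indGen k (N + 1 + m) a))
  rw [inv_lin_hom_lin, hφ] at hpε
  have hS : (ShortComplex.mk (Limits.kernel.ι p) p (Limits.kernel.condition p)).ShortExact :=
    { exact := ShortComplex.exact_kernel p }
  obtain ⟨κ, hκ⟩ : ∃ κ, linMap Φ _ P (Limits.kernel.ι p) κ =
      ((Φ.obj P).x ^ (N + 1)) (e.inv.lin (indGen k (N + 1 + m) a)) :=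
    exists_of_shortExact Φ hS _ (by
      refine (linMap_x_pow p _ _).trans ?_
      rw [hpε, hX.x_pow, LinearMap.zero_apply])
  exact ⟨_, P, Limits.kernel.ι p, p, Limits.kernel.condition p, hS, _, κ, _, _, hP,
    isUniserial_kernel hX hP (injective_of_mono Φ _) (Limits.kernel.condition p) hpε hκ, hκ,
    fun Y hY ↦ connectingMap_surjective hS e hX.x_pow hY (by omega)⟩

theorem CycMod.IsUniserial.exists_linMap_eq {X Y : T} {a : ZMod r} {N : ℕ} {v : (Φ.obj X).V}
    {l : (Φ.obj X).V →ₗ[k] k} (hX : (Φ.obj X).IsUniserial a N v l) {y : (Φ.obj Y).V}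
    (hy : (Φ.obj Y).π a y = y) (hxy : ((Φ.obj Y).x ^ (N + 1)) y = 0) :
    ∃ f, linMap Φ X Y f v = y := by
  obtain ⟨f, hf⟩ := hX.exists_hom hy hxy
  obtain ⟨g, hg⟩ := FPTube.exists_linMap_eq f
  exact ⟨g, by rw [hg, hf]⟩

theorem CycMod.IsUniserial.eq_of_linMap_eq {X Y : T} {a : ZMod r} {N : ℕ} {v : (Φ.obj X).V}
    {l : (Φ.obj X).V →ₗ[k] k} (hX : (Φ.obj X).IsUniserial a N v l) {f g : X ⟶ Y}
    (h : linMap Φ X Y f v = linMap Φ X Y g v) : f = g :=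
  Φ.map_injective (hX.hom_ext h)

/-- Let `X` and `Y` be uniserial, the latter of length at most `r`. Then `Ext¹(X, Y)` is a quotient
of `Hom(K, Y)`, where `K` is the kernel of a cover `P` of `X`, and this space is at most
one-dimensional since the top of `K` occurs at most once in `Y`. If it occurs at `xˢ v'` with
`s > N`, then every map from `K` to `Y` extends to `P`. -/
theorem finrank_ext_le_one [HasExt.{w} T] {X Y : T} {a b : ZMod r} {N M : ℕ} {v : (Φ.obj X).V}
    {v' : (Φ.obj Y).V} {l : (Φ.obj X).V →ₗ[k] k} {l' : (Φ.obj Y).V →ₗ[k] k}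
    (hX : (Φ.obj X).IsUniserial a N v l) (hY : (Φ.obj Y).IsUniserial b M v' l')
    (hM : M < r) : Module.finrank k (Ext.{w} X Y 1) ≤ 1 ∧ (Module.finrank k (Ext.{w} X Y 1) ≠ 0 →
      ∃ s, s ≤ M ∧ s ≤ N ∧ b + s = a + N + 1) := by
  obtain ⟨K, P, i, p, hip, hS, ε, κ, L, L', hP, hK, hκ, hsurj⟩ :=
    exists_presentation.{w} hX M
  have hsurj' := hsurj Y hY.x_pow
  have hdeg (g : K ⟶ Y) : (Φ.obj Y).π (a + N + 1) (linMap Φ K Y g κ) = linMap Φ K Y g κ := by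
    rw [← linMap_π, hK.π_gen]
  have := finite_hom Φ K Y
  constructor
  · refine (LinearMap.finrank_le_finrank_of_surjective hsurj').trans ?_
    by_cases h : ∀ g : K ⟶ Y, g = 0
    · exact finrank_le_one 0 fun g ↦ ⟨0, by rw [h g, smul_zero]⟩
    push Not at h
    obtain ⟨g₀, hg₀⟩ := h
    have hne (g : K ⟶ Y) (hg : g ≠ 0) : linMap Φ K Y g κ ≠ 0 := fun h ↦
      hg (hK.eq_of_linMap_eq (f := g) (g := 0) (by rw [h, map_zero]; rfl))
    refine finrank_le_one g₀ fun g ↦ ?_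
    by_cases hg : g = 0
    · exact ⟨0, by rw [hg, zero_smul]⟩
    obtain ⟨s₀, hs₀, h₀, c₀, hc₀⟩ := hY.eq_smul_of_homogeneous hM (hdeg g₀) (hne g₀ hg₀)
    obtain ⟨s, hs, h, c, hc⟩ := hY.eq_smul_of_homogeneous hM (hdeg g) (hne g hg)
    obtain rfl : s = s₀ :=
      natCast_inj (by omega) (by omega) (add_left_cancel (h.trans h₀.symm))
    have hc₀' : c₀ ≠ 0 := fun h0 ↦ hne g₀ hg₀ (by rw [hc₀, h0, zero_smul])
    refine ⟨c / c₀, hK.eq_of_linMap_eq ?_⟩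
    rw [map_smul, LinearMap.smul_apply, hc₀, hc, smul_smul, div_mul_cancel₀ _ hc₀']
  · intro hne
    obtain ⟨g, hg⟩ : ∃ g, connectingMap.{w} k hS Y g ≠ 0 := by
      by_contra! h
      have : Subsingleton (Ext.{w} X Y 1) := ⟨fun α β ↦ by
        obtain ⟨f, rfl⟩ := hsurj' α
        obtain ⟨g, rfl⟩ := hsurj' β
        rw [h, h]⟩
      exact hne Module.finrank_zero_of_subsingleton
    have hg0 : linMap Φ K Y g κ ≠ 0 := fun h ↦
      hg (by rw [hK.eq_of_linMap_eq (f := g) (g := 0) (by rw [h, map_zero]; rfl), map_zero])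
    obtain ⟨s, hs, h, c, hc⟩ := hY.eq_smul_of_homogeneous hM (hdeg g) hg0
    refine ⟨s, hs, ?_, h⟩
    by_contra! hlt
    -- the map `g` extends to `P`
    obtain ⟨f, hf⟩ := hP.exists_linMap_eq (y := c • ((Φ.obj Y).x ^ (s - (N + 1))) v') (by
        rw [map_smul, π_x_pow hY.π_gen, if_pos]
        rw [Nat.cast_sub (by omega)]
        push_cast
        linear_combination -h) (by
        rw [pow_eq_zero_of_le (by omega) hY.x_pow, LinearMap.zero_apply])
    refine hg ((connectingMap_eq_zero_iff hS g).2 ⟨f, hK.eq_of_linMap_eq ?_⟩)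
    rw [hc]
    refine (linMap_comp i f κ).trans ?_
    rw [hκ, linMap_x_pow, hf, map_smul, ← Module.End.mul_apply, ← pow_add,
      Nat.add_sub_cancel' (by omega)]

/-- There is a nonsplit extension of the simple object at `a` by the simple object at `a + 1`. -/
theorem finrank_ext_ne_zero [HasExt.{w} T] {X Y : T} {a : ZMod r} {v : (Φ.obj X).V}
    {v' : (Φ.obj Y).V} {l : (Φ.obj X).V →ₗ[k] k} {l' : (Φ.obj Y).V →ₗ[k] k}
    (hX : (Φ.obj X).IsUniserial a 0 v l) (hY : (Φ.obj Y).IsUniserial (a + 1) 0 v' l') :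
    Module.finrank k (Ext.{w} X Y 1) ≠ 0 := by
  obtain ⟨K, P, i, p, hip, hS, ε, κ, L, L', -, hK, hκ, -⟩ :=
    exists_presentation.{w} hX 0
  have hx := hY.x_pow
  obtain ⟨g, hg⟩ := hK.exists_linMap_eq (Y := Y) (y := v') (by simpa using hY.π_gen)
    (by rw [hx, LinearMap.zero_apply])
  have := finite_ext.{w} Φ X Y
  intro h0
  have hsub : Subsingleton (Ext.{w} X Y 1) := Module.finrank_zero_iff.1 h0
  obtain ⟨f, rfl⟩ := (connectingMap_eq_zero_iff.{w} (k := k) hS g).1 (hsub.elim _ _)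
  -- a map from `P` to `Y` that extends `g` kills `κ = x ε`, since `x` vanishes on `Y`
  refine hY.x_pow_gen_ne_zero (s := 0) le_rfl ?_
  rw [pow_zero, Module.End.one_apply, ← hg]
  refine (linMap_comp i f κ).trans ?_
  rw [hκ, linMap_x_pow, hx, LinearMap.zero_apply]

end UniserialExt

/-! ### Partial permutation matrices -/

section Matrices

variable {n : ℕ}

/-- A matrix whose entries are `0` and `1`, with at most one nonzero entry in each row and in each
column. -/
def IsPartialPerm (A : Matrix (Fin n) (Fin n) ℕ) : Prop :=
  (∀ i j, A i j ≤ 1) ∧ (∀ i j j', A i j ≠ 0 → A i j' ≠ 0 → j = j') ∧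
    ∀ i i' j, A i j ≠ 0 → A i' j ≠ 0 → i = i'

attribute [local instance] Matrix.linftyOpNormedRing Matrix.linftyOpNormedAlgebra in
/-- The maximal row sum is a norm that bounds the spectral radius. -/
theorem IsPartialPerm.rho_le_one {A : Matrix (Fin n) (Fin n) ℕ} (hA : IsPartialPerm A) :
    rho A ≤ 1 := by
  rcases isEmpty_or_nonempty (Fin n) with h | h
  · have : Subsingleton (Matrix (Fin n) (Fin n) ℂ) := inferInstance
    simp [rho, spectralRadius, spectrum.of_subsingleton]
  refine (spectrum.spectralRadius_le_nnnorm _).trans ?_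
  rw [ENNReal.coe_le_one_iff, Matrix.linfty_opNNNorm_def]
  refine Finset.sup_le fun i _ ↦ ?_
  by_cases h : ∃ j, A i j ≠ 0
  · obtain ⟨j, hj⟩ := h
    rw [Finset.sum_eq_single j]
    · have : A i j = 1 := le_antisymm (hA.1 i j) (Nat.pos_of_ne_zero hj)
      simp [this]
    · intro j' _ hne
      have : A i j' = 0 := by_contra fun h ↦ hne (hA.2.1 i j' j h hj)
      simp [this]
    · simp
  · push Not at h
    simp [h]

theorem cyclicMatrix_apply (i j : Fin n) :
    cyclicMatrix n i j = if finRotate n i = j then 1 else 0 := by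
  simp [cyclicMatrix, Equiv.Perm.permMatrix, PEquiv.toMatrix_apply]

theorem isPartialPerm_cyclicMatrix : IsPartialPerm (cyclicMatrix n) := by
  refine ⟨fun i j ↦ ?_, fun i j j' hj hj' ↦ ?_, fun i i' j hi hi' ↦ ?_⟩
  · rw [cyclicMatrix_apply]; split_ifs <;> simp
  · rw [cyclicMatrix_apply] at hj hj'
    simp only [ne_eq, ite_eq_right_iff, one_ne_zero, imp_false, not_not] at hj hj'
    rw [← hj, ← hj']
  · rw [cyclicMatrix_apply] at hi hi'
    simp only [ne_eq, ite_eq_right_iff, one_ne_zero, imp_false, not_not] at hi hi'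
    exact (finRotate n).injective (hi.trans hi'.symm)

/-- The all-ones vector is an eigenvector with eigenvalue `1`. -/
theorem rho_cyclicMatrix (hn : 1 ≤ n) : rho (cyclicMatrix n) = 1 := by
  refine le_antisymm isPartialPerm_cyclicMatrix.rho_le_one ?_
  have h1 : (1 : ℂ) ∈ spectrum ℂ ((cyclicMatrix n).map (Nat.cast : ℕ → ℂ)) := by
    rw [← Matrix.spectrum_toLin', ← Module.End.hasEigenvalue_iff_mem_spectrum]
    refine Module.End.hasEigenvalue_of_hasEigenvector (x := fun _ ↦ 1) ⟨?_, fun h ↦ ?_⟩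
    · rw [Module.End.mem_eigenspace_iff]
      ext i
      simp [Matrix.toLin'_apply, Matrix.mulVec, dotProduct, cyclicMatrix_apply]
    · exact one_ne_zero (congrFun h ⟨0, hn⟩)
  have := le_iSup₂ (f := fun (z : ℂ) (_ : z ∈ spectrum ℂ
    ((cyclicMatrix n).map (Nat.cast : ℕ → ℂ))) ↦ (‖z‖₊ : ℝ≥0∞)) 1 h1
  simpa [rho, spectralRadius] using this

/-- A set of indices that no nonzero entry leaves is everything, if the matrix is irreducible. -/
theorem IsIrreducibleMatrix.eq_univ {A : Matrix (Fin n) (Fin n) ℕ} (hA : IsIrreducibleMatrix A)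
    (s : Finset (Fin n)) (hs : s.Nonempty) (h : ∀ i ∈ s, ∀ j ∉ s, A i j = 0) : ∀ j, j ∈ s := by
  by_contra! hne
  obtain ⟨j, hj⟩ := hne
  let e : Fin n ≃ Fin (Fintype.card {j // j ∉ s}) ⊕ Fin (Fintype.card {j // ¬ j ∉ s}) :=
    (Equiv.sumCompl (· ∉ s)).symm.trans
      ((Fintype.equivFin {j // j ∉ s}).sumCongr (Fintype.equivFin {j // ¬ j ∉ s}))
  refine hA ⟨_, _, e, Fintype.card_pos_iff.2 ⟨⟨j, hj⟩⟩, ?_, ?_⟩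
  · obtain ⟨i, hi⟩ := hs
    exact Fintype.card_pos_iff.2 ⟨⟨i, not_not.2 hi⟩⟩
  · ext a b
    exact h _ (not_not.1 ((Fintype.equivFin {j // ¬ j ∉ s}).symm a).2) _
      ((Fintype.equivFin {j // j ∉ s}).symm b).2

/-- An irreducible partial permutation matrix is zero of size one, or a cyclic permutation
matrix. -/
theorem IsPartialPerm.eq_zero_or_cyclic {A : Matrix (Fin n) (Fin n) ℕ} (hA : IsPartialPerm A)
    (hn : 1 ≤ n) (hirr : IsIrreducibleMatrix A) :
    (n = 1 ∧ A = 0) ∨ ∃ σ : Equiv.Perm (Fin n), A.submatrix σ σ = cyclicMatrix n := by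
  classical
  by_cases hz : ∃ i, ∀ j, A i j = 0
  · left
    obtain ⟨i, hi⟩ := hz
    have h := hirr.eq_univ {i} (Finset.singleton_nonempty i) (by simpa using fun j _ ↦ hi j)
    have h' (j : Fin n) : j = i := by simpa using h j
    refine ⟨?_, ?_⟩
    · have : Fintype.card (Fin n) ≤ 1 := Fintype.card_le_one_iff.2 fun a b ↦ by rw [h' a, h' b]
      rw [Fintype.card_fin] at this
      omega
    · ext a b
      rw [h' a, hi, Matrix.zero_apply]
  · right
    push Not at hz
    choose f hf using hz
    have hfA (i j) : A i j = if f i = j then 1 else 0 := by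
      split_ifs with h
      · rw [← h]
        exact le_antisymm (hA.1 _ _) (Nat.pos_of_ne_zero (hf i))
      · exact by_contra fun h' ↦ h (hA.2.1 i _ _ (hf i) h')
    have hinj : Function.Injective f := fun i i' h ↦ hA.2.2 i i' (f i) (hf i) (h ▸ hf i')
    let i₀ : Fin n := ⟨0, hn⟩
    -- the orbit of `i₀` is everything
    have horb (j : Fin n) : ∃ m, f^[m] i₀ = j := by
      have h := hirr.eq_univ (Finset.univ.filter fun j ↦ ∃ m, f^[m] i₀ = j)
        ⟨i₀, by simpa using ⟨0, rfl⟩⟩ (fun i hi j hj ↦ by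
          simp only [Finset.mem_filter, Finset.mem_univ, true_and] at hi hj
          obtain ⟨m, rfl⟩ := hi
          rw [hfA, if_neg]
          intro h
          exact hj ⟨m + 1, by rw [Function.iterate_succ_apply', h]⟩) j
      simpa using h
    let g : Equiv.Perm (Fin n) := Equiv.ofBijective f (Finite.injective_iff_bijective.1 hinj)
    have hgf (m : ℕ) (j) : (g ^ m) j = f^[m] j := by
      rw [Equiv.Perm.coe_pow]
      rfl
    have hg : g.IsCycleOn ((Finset.univ : Finset (Fin n)) : Set (Fin n)) := by
      rw [Finset.coe_univ]
      refine ⟨Set.bijOn_univ.2 g.bijective, fun a _ b _ ↦ ?_⟩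
      obtain ⟨m, rfl⟩ := horb a
      obtain ⟨m', rfl⟩ := horb b
      rw [← hgf, ← hgf, Equiv.Perm.sameCycle_pow_left, Equiv.Perm.sameCycle_pow_right]
    have hσ : Function.Surjective fun m : Fin n ↦ (g ^ m.1) i₀ := fun j ↦ by
      obtain ⟨m, hm, hj⟩ := hg.exists_pow_eq (Finset.mem_univ i₀) (Finset.mem_univ j)
      exact ⟨⟨m, by simpa using hm⟩, hj⟩
    refine ⟨Equiv.ofBijective _ (Finite.surjective_iff_bijective.1 hσ), ?_⟩
    ext i j
    have hrot : g ((g ^ i.1) i₀) = (g ^ (finRotate n i).1) i₀ := by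
      obtain ⟨n, rfl⟩ : ∃ n', n = n' + 1 := ⟨n - 1, by omega⟩
      rw [← Equiv.Perm.mul_apply, ← pow_succ', coe_finRotate]
      split_ifs with h
      · rw [h, Fin.val_last]
        simpa using hg.pow_card_apply (Finset.mem_univ i₀)
      · rfl
    rw [Matrix.submatrix_apply, hfA, cyclicMatrix_apply]
    refine if_congr ?_ rfl rfl
    change g ((g ^ i.1) i₀) = (g ^ j.1) i₀ ↔ _
    rw [hrot]
    exact (Finite.surjective_iff_bijective.1 hσ).1.eq_iff

end Matrices

/-! ### Brick sets in a tube -/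

section Bricks

variable {k : Type t} [Field k] {r : ℕ} [NeZero r] {T : Type u} [Category.{v} T]
    [Abelian T] [Linear k T]

open CycMod

theorem IsBrick.exists_isUniserial (Φ : T ⥤ CycMod k r) [IsTotalSpace Φ] {X : T}
    (hX : IsBrick k X) :
    ∃ a N v l, N < r ∧ (Φ.obj X).IsUniserial a N v l := by
  have : Nontrivial (Φ.obj X).V := by
    by_contra h
    rw [not_nontrivial_iff_subsingleton] at h
    have h0 (f : X ⟶ X) : f = 0 :=
      linMap_injective (Φ := Φ) (LinearMap.ext fun v ↦ Subsingleton.elim _ _)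
    exact one_ne_zero (hX.1 ((h0 _).trans (h0 ((0 : k) • 𝟙 X)).symm))
  refine CycMod.exists_isUniserial fun f ↦ ?_
  obtain ⟨g, hg⟩ := exists_linMap_eq f
  obtain ⟨c, rfl⟩ := hX.2 g
  refine ⟨c, fun w ↦ ?_⟩
  rw [← hg]
  simp only [map_smul, LinearMap.smul_apply, linMap_id]

theorem IsBrickSet.hom_eq_zero {n : ℕ} {X : Fin n → T} (hX : IsBrickSet k X) {i j : Fin n}
    (hij : i ≠ j) (f : X i ⟶ X j) : f = 0 := by
  have h := hX.2 i j
  rw [if_neg hij, rank_zero_iff] at h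
  exact h.elim _ _

/-- In a brick set, `Ext¹(X, Y) ≠ 0` forces the top of `Y` to follow the socle of `X`. Since members
of a brick set are determined by their tops, and by their socles, the adjacency matrix is a partial
permutation matrix. -/
theorem IsBrickSet.isPartialPerm [HasExt.{w} T] (Φ : T ⥤ CycMod k r) [IsTotalSpace Φ] {n : ℕ}
    {X : Fin n → T} (hX : IsBrickSet k X) :
    IsPartialPerm (adjacencyMatrix.{w} k X) := by
  choose a N v l hN hu using fun i ↦ (hX.1 i).exists_isUniserial Φ
  have hhom {i j : Fin n} (hij : i ≠ j) {y : (Φ.obj (X j)).V} (hy : (Φ.obj (X j)).π (a i) y = y)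
      (hxy : ((Φ.obj (X j)).x ^ (N i + 1)) y = 0) : y = 0 := by
    obtain ⟨f, rfl⟩ := (hu i).exists_linMap_eq hy hxy
    rw [hX.hom_eq_zero hij f, map_zero, LinearMap.zero_apply]
  have htop {i j : Fin n} (h : a i = a j) : i = j := by
    wlog hle : N j ≤ N i generalizing i j
    · exact (this h.symm (by omega)).symm
    by_contra hij
    refine (hu j).x_pow_gen_ne_zero (Nat.zero_le _) (hhom hij ?_ ?_)
    · rw [h]
      exact (hu j).π_gen
    · rw [pow_eq_zero_of_le (by omega) (hu j).x_pow, LinearMap.zero_apply]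
  have hsocle {i j : Fin n} (h : a i + N i = a j + N j) : i = j := by
    wlog hle : N j ≤ N i generalizing i j
    · exact (this h.symm (by omega)).symm
    by_contra hij
    refine (hu i).x_pow_gen_ne_zero (s := N i - N j) (Nat.sub_le _ _) (hhom (Ne.symm hij) ?_ ?_)
    · rw [π_x_pow (hu i).π_gen, if_pos]
      rw [Nat.cast_sub hle]
      linear_combination -h
    · rw [← Module.End.mul_apply, ← pow_add, show N j + 1 + (N i - N j) = N i + 1 by omega,
        (hu i).x_pow, LinearMap.zero_apply]
  have hext {i j : Fin n} (h : adjacencyMatrix.{w} k X i j ≠ 0) : a j = a i + N i + 1 := by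
    obtain ⟨s, hsj, hsi, hs⟩ := (finrank_ext_le_one.{w} (hu i) (hu j) (hN j)).2 h
    rcases Nat.eq_zero_or_pos s with rfl | hpos
    · simpa using hs
    exfalso
    rcases eq_or_ne i j with rfl | hij
    · -- `0 < s < N + 1 ≤ r` contradicts `s = N + 1` modulo `r`
      have h' : ((s : ℕ) : ZMod r) = (N i + 1 : ℕ) := by
        push_cast
        linear_combination hs
      rcases (Nat.succ_le_of_lt (hN i)).lt_or_eq with hlt | heq
      · have := natCast_inj ((Nat.lt_succ_of_le hsi).trans hlt) hlt h'
        omega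
      · rw [show N i + 1 = r from heq, ZMod.natCast_self, ← Nat.cast_zero] at h'
        have := natCast_inj (lt_of_le_of_lt hsi (hN i)) (NeZero.pos r) h'
        omega
    · -- otherwise the top of `X j` occurs in `X i` so low that `X j` maps to `X i`
      refine (hu i).x_pow_gen_ne_zero (s := N i + 1 - s) (by omega) (hhom (Ne.symm hij) ?_ ?_)
      · rw [π_x_pow (hu i).π_gen, if_pos]
        rw [Nat.cast_sub (by omega)]
        push_cast
        linear_combination hs
      · rw [← Module.End.mul_apply, ← pow_add, pow_eq_zero_of_le (by omega) (hu i).x_pow,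
          LinearMap.zero_apply]
  refine ⟨fun i j ↦ (finrank_ext_le_one.{w} (hu i) (hu j) (hN j)).1, fun i j j' h h' ↦ ?_,
    fun i i' j h h' ↦ ?_⟩
  · exact htop ((hext h).trans (hext h').symm)
  · exact hsocle (add_right_cancel ((hext h).symm.trans (hext h')))

end Bricks

/-! ### Simple objects of a tube -/

section Simples

theorem CycMod.IsUniserial.eq_smul_gen {k : Type t} [Field k] {r : ℕ} [NeZero r] {A : CycMod k r}
    {a : ZMod r} {v : A.V} {l : A.V →ₗ[k] k} (hA : A.IsUniserial a 0 v l) (y : A.V) :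
    y = l y • v := by
  simpa using hA.eq_sum y

variable {k : Type t} [Field k] {r : ℕ} [NeZero r] {T : Type u} [Category.{v} T]
    [Abelian T] [Linear k T] {Φ : T ⥤ CycMod k r} [IsTotalSpace Φ]

open CycMod

theorem simple_of_isUniserial {X : T} {a : ZMod r} {v : (Φ.obj X).V} {l : (Φ.obj X).V →ₗ[k] k}
    (hX : (Φ.obj X).IsUniserial a 0 v l) : Simple X where
  mono_isIso_iff_nonzero {Y} f _ := by
    constructor
    · rintro hf rfl
      refine hX.x_pow_gen_ne_zero (s := 0) le_rfl ?_
      rw [pow_zero, Module.End.one_apply, ← linMap_id v, ← IsIso.inv_hom_id (0 : Y ⟶ X),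
        Limits.comp_zero, map_zero, LinearMap.zero_apply]
    · intro hf
      obtain ⟨y, hy⟩ : ∃ y, linMap Φ Y X f y ≠ 0 := by
        by_contra! h
        exact hf (linMap_injective (Φ := Φ) (LinearMap.ext fun y ↦ by rw [h, map_zero]; rfl))
      have hl : l (linMap Φ Y X f y) ≠ 0 := fun h ↦ hy (by
        rw [hX.eq_smul_gen (linMap Φ Y X f y), h, zero_smul])
      have : Epi f := epi_of_surjective (Φ := Φ) f fun z ↦
        ⟨(l z / l (linMap Φ Y X f y)) • y, by
          obtain ⟨c, hc⟩ : ∃ c, c = l (linMap Φ Y X f y) := ⟨_, rfl⟩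
          rw [← hc] at hl ⊢
          rw [map_smul, hX.eq_smul_gen (linMap Φ Y X f y), ← hc, smul_smul, div_mul_cancel₀ _ hl,
            ← hX.eq_smul_gen z]⟩
      exact isIso_of_mono_of_epi f

/-- A homogeneous component of a nonzero element `xᴺ w`, with `N` maximal, is killed by `x`, hence
is the image of the generator of some `S a`. -/
theorem exists_iso_of_simple {X : T} (hX : Simple X) {S : ZMod r → T}
    {v : ∀ a, (Φ.obj (S a)).V} {l : ∀ a, (Φ.obj (S a)).V →ₗ[k] k}
    (hS : ∀ a, (Φ.obj (S a)).IsUniserial a 0 (v a) (l a)) : ∃ a, Nonempty (X ≅ S a) := by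
  obtain ⟨M, hM⟩ := (Φ.obj X).nilpotent
  have hne : (Φ.obj X).x ^ 0 ≠ 0 := fun h ↦ id_nonzero X
    (linMap_injective (Φ := Φ) (LinearMap.ext fun y ↦ by
      have := LinearMap.congr_fun h y
      rw [pow_zero, Module.End.one_apply] at this
      rw [linMap_id, map_zero, this]; rfl))
  classical
  have hex : ∃ m, (Φ.obj X).x ^ m = 0 := ⟨M, hM⟩
  obtain ⟨N, hN⟩ : ∃ N, Nat.find hex = N + 1 := Nat.exists_eq_succ_of_ne_zero fun h ↦
    hne (h ▸ Nat.find_spec hex)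
  have hx : (Φ.obj X).x ^ (N + 1) = 0 := hN ▸ Nat.find_spec hex
  have hxN : (Φ.obj X).x ^ N ≠ 0 := Nat.find_min hex (by omega)
  obtain ⟨a, w, hw⟩ : ∃ a w, (Φ.obj X).π a (((Φ.obj X).x ^ N) w) ≠ 0 := by
    by_contra! h
    refine hxN (LinearMap.ext fun w ↦ ?_)
    rw [← (Φ.obj X).sum_π (((Φ.obj X).x ^ N) w)]
    exact Finset.sum_eq_zero fun i _ ↦ h i w
  obtain ⟨f, hf⟩ := (hS a).exists_linMap_eq (Y := X) (y := (Φ.obj X).π a (((Φ.obj X).x ^ N) w))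
    (by rw [π_π, if_pos rfl])
    (by
      have hw : (Φ.obj X).x (((Φ.obj X).x ^ N) w) = 0 := by
        rw [← Module.End.mul_apply, ← pow_succ', hx, LinearMap.zero_apply]
      rw [zero_add, pow_one, x_π, hw, map_zero])
  have := simple_of_isUniserial (hS a)
  have hf0 : f ≠ 0 := fun h ↦ hw (by rw [← hf, h, map_zero, LinearMap.zero_apply])
  have := isIso_of_hom_simple hf0
  exact ⟨a, ⟨(asIso f).symm⟩⟩

theorem isBrick_of_isUniserial {X : T} {a : ZMod r} {v : (Φ.obj X).V} {l : (Φ.obj X).V →ₗ[k] k}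
    (hX : (Φ.obj X).IsUniserial a 0 v l) : IsBrick k X := by
  have hv : v ≠ 0 := hX.x_pow_gen_ne_zero (s := 0) le_rfl
  refine ⟨fun c c' h ↦ smul_left_injective k hv ?_, fun f ↦ ⟨l (linMap Φ X X f v),
    hX.eq_of_linMap_eq ?_⟩⟩
  · have := congrArg (fun f ↦ linMap Φ X X f v) h
    simpa only [map_smul, LinearMap.smul_apply, linMap_id] using this
  · simp only [map_smul, LinearMap.smul_apply, linMap_id]
    exact (hX.eq_smul_gen _).symm

theorem hom_eq_zero_of_isUniserial {X Y : T} {a b : ZMod r} {v : (Φ.obj X).V}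
    {v' : (Φ.obj Y).V} {l : (Φ.obj X).V →ₗ[k] k} {l' : (Φ.obj Y).V →ₗ[k] k}
    (hX : (Φ.obj X).IsUniserial a 0 v l) (hY : (Φ.obj Y).IsUniserial b 0 v' l') (hab : a ≠ b)
    (f : X ⟶ Y) : f = 0 := by
  refine hX.eq_of_linMap_eq ?_
  rw [map_zero, LinearMap.zero_apply, ← hX.π_gen, linMap_π, hY.eq_smul_gen (linMap Φ X Y f v),
    map_smul, ← hY.π_gen, π_π, if_neg hab, smul_zero]

theorem isBrickSet_simples {n : ℕ} {S : Fin n → T} {a : Fin n → ZMod r}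
    (ha : Function.Injective a) {v : ∀ i, (Φ.obj (S i)).V} {l : ∀ i, (Φ.obj (S i)).V →ₗ[k] k}
    (hS : ∀ i, (Φ.obj (S i)).IsUniserial (a i) 0 (v i) (l i)) : IsBrickSet k S := by
  refine ⟨fun i ↦ isBrick_of_isUniserial (hS i), fun i j ↦ ?_⟩
  split_ifs with h
  · subst h
    have hb := isBrick_of_isUniserial (hS i)
    refine rank_eq_one (𝟙 (S i)) (fun h ↦ ?_) hb.2
    exact one_ne_zero (hb.1 (by simp only [h, smul_zero]) : (1 : k) = 0)
  · rw [rank_zero_iff]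
    refine ⟨fun f g ↦ ?_⟩
    rw [hom_eq_zero_of_isUniserial (hS i) (hS j) (ha.ne h) f,
      hom_eq_zero_of_isUniserial (hS i) (hS j) (ha.ne h) g]

theorem natCast_finRotate (i : Fin r) : ((finRotate r i : ℕ) : ZMod r) = (i : ℕ) + 1 := by
  obtain ⟨n, rfl⟩ : ∃ n, r = n + 1 := ⟨r - 1, by have := NeZero.pos r; omega⟩
  rw [coe_finRotate]
  split_ifs with h
  · rw [h, Fin.val_last, Nat.cast_zero, ← Nat.cast_succ, ZMod.natCast_self]
  · push_cast
    rfl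

theorem adjacencyMatrix_simples [HasExt.{w} T] {S : Fin r → T} {v : ∀ i, (Φ.obj (S i)).V}
    {l : ∀ i, (Φ.obj (S i)).V →ₗ[k] k}
    (hS : ∀ i, (Φ.obj (S i)).IsUniserial (i : ℕ) 0 (v i) (l i)) :
    adjacencyMatrix.{w} k S = cyclicMatrix r := by
  ext i j
  obtain ⟨h₁, h₂⟩ := finrank_ext_le_one.{w} (hS i) (hS j) (NeZero.pos r)
  change Module.finrank k (Ext.{w} (S i) (S j) 1) = _
  rw [cyclicMatrix_apply]
  split_ifs with h
  · have hj := hS j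
    rw [← h, natCast_finRotate] at hj
    have := finrank_ext_ne_zero.{w} (hS i) (h ▸ hj)
    omega
  · by_contra hne
    obtain ⟨s, hs, -, heq⟩ := h₂ hne
    obtain rfl : s = 0 := by omega
    rw [Nat.cast_zero, add_zero, add_zero, ← natCast_finRotate] at heq
    exact h (Fin.ext (natCast_inj j.2 (finRotate r i).2 heq).symm)

end Simples

end FPTube

end

theorem corollary5p2 {k : Type t} [Field k] [IsAlgClosed k]
    {T : Type u} [Category.{v} T] [Abelian T] [Linear k T] [HasExt.{w} T]
    (r : ℕ) (hT : FPTube.IsTube k r T) :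
    -- the entries of adjacency matrices are dimensions of finite-dimensional spaces
    (∀ X Y : T, Module.Finite k (Ext.{w} X Y 1)) ∧
    FPTube.fpdim.{w} k T = 1 ∧
    -- irreducible adjacency matrices of brick sets
    (∀ (n : ℕ) (X : Fin n → T), 1 ≤ n → FPTube.IsBrickSet k X →
      FPTube.IsIrreducibleMatrix (FPTube.adjacencyMatrix.{w} k X) →
        (n = 1 ∧ FPTube.adjacencyMatrix.{w} k X = 0) ∨
        ∃ σ : Equiv.Perm (Fin n),
          (FPTube.adjacencyMatrix.{w} k X).submatrix σ σ = FPTube.cyclicMatrix n) ∧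
    -- the simple objects form a brick set at which the value is attained
    (∃ S : Fin r → T, (∀ i, Simple (S i)) ∧
      (∀ X : T, Simple X → ∃ i, Nonempty (X ≅ S i)) ∧
      FPTube.IsBrickSet k S ∧
      FPTube.adjacencyMatrix.{w} k S = FPTube.cyclicMatrix r ∧
      FPTube.rho (FPTube.adjacencyMatrix.{w} k S) = 1) := by
  have hr : NeZero r := ⟨Nat.one_le_iff_ne_zero.1 hT.1⟩
  obtain ⟨Φ, hΦ⟩ := hT.exists_isTotalSpace
  let S (a : ZMod r) : T := Φ.objPreimage (FPTube.CycMod.simple k a)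
  have hS (a : ZMod r) :=
    (FPTube.CycMod.isUniserial_simple (k := k) a).of_iso (Φ.objObjPreimageIso _)
  have hinj : Function.Injective fun i : Fin r ↦ ((i : ℕ) : ZMod r) := fun i j h ↦
    Fin.ext (FPTube.CycMod.natCast_inj i.2 j.2 h)
  have hbrick : FPTube.IsBrickSet k fun i : Fin r ↦ S (i : ℕ) :=
    FPTube.isBrickSet_simples hinj fun i ↦ hS (i : ℕ)
  have hadj : FPTube.adjacencyMatrix.{w} k (fun i : Fin r ↦ S (i : ℕ)) = FPTube.cyclicMatrix r :=
    FPTube.adjacencyMatrix_simples.{w} fun i ↦ hS (i : ℕ)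
  have hrho := FPTube.rho_cyclicMatrix hT.1
  refine ⟨FPTube.finite_ext Φ, le_antisymm ?_ ?_, fun n X hn hX hirr ↦
    (hX.isPartialPerm Φ).eq_zero_or_cyclic hn hirr, fun i ↦ S (i : ℕ),
    fun i ↦ FPTube.simple_of_isUniserial (hS (i : ℕ)), fun X hX ↦ ?_, hbrick, hadj, hadj ▸ hrho⟩
  · exact iSup₂_le fun n _ ↦ iSup₂_le fun X hX ↦ (hX.isPartialPerm Φ).rho_le_one
  · rw [← hrho, ← hadj]
    exact le_iSup₂_of_le r hT.1 (le_iSup₂_of_le (f := fun (X : Fin r → T)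
      (_ : FPTube.IsBrickSet k X) ↦ FPTube.rho (FPTube.adjacencyMatrix.{w} k X)) _ hbrick le_rfl)
  · obtain ⟨a, ⟨e⟩⟩ := FPTube.exists_iso_of_simple hX hS
    refine ⟨⟨a.val, a.val_lt⟩, ⟨e.trans (eqToIso ?_)⟩⟩
    exact congrArg S (ZMod.natCast_zmod_val a).symm
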